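/- Let $(I,\mathcal A,\mu)$ be a probability space, $|A|:=\mu(A)$, with a good grid $(\mathcal P^k)_{k\ge 0}$: finite families of measurable sets, each a partition of $I$ up to null sets, with $\mathcal P^0=\{I\}$; every $Q\in\mathcal P^{k+1}$ lies in some $P\in\mathcal P^k$; for some $\lambda_*,\lambda\in(0,1)$ one has $\lambda_*\le |Q|/|P|\le\lambda$ whenever $Q\in\mathcal P^{k+1}$, $P\in\mathcal P^k$, $Q\subset P$ ($Q$ is then a child of $P$); and $\bigcup_k\mathcal P^k$ generates $\mathcal A$. Fix a total order on the set of children of each $Q\in\mathcal P^k$. Let $\mathcal H_Q$ be the set of pairs $(S_1,S_2)$ obtained by cutting the ordered list of children, of length $n$, into its first $\lfloor n/2\rfloor$ and its remaining entries, and repeating this with each part that has at least two entries. Put $\phi_{(S_1,S_2)}=\frac{\sum_{P\in S_1}1_P}{\sum_{P\in S_1}|P|}-\frac{\sum_{R\in S_2}1_R}{\sum_{R\in S_2}|R|}$. Let $s>0$. The space $B^s_{\infty,\infty}$ consists of all $\psi\in L^\infty(I)$ of the form $\psi=c_I1_I+\sum_{k}\sum_{Q\in\mathcal P^k}\sum_{S\in\mathcal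 H_Q}|Q|^{1+s}c_S\phi_S$ (partial sums over $k$ converging in $L^\infty$) with $|\psi|_{B^s_{\infty,\infty}}=|c_I|+\sup_S|c_S|<\infty$. The space $B^{-s}_{1,1}$ consists of all continuous linear functionals $\varphi$ on $B^s_{\infty,\infty}$ of the form $\varphi(\psi)=d_I\int\psi\,d\mu+\sum_{k}\sum_{Q\in\mathcal P^k}\sum_{S\in\mathcal H_Q}d_S|Q|^{-s}\int\psi\phi_S\,d\mu$ with $|\varphi|_{B^{-s}_{1,1}}=|d_I|+\sum_S|d_S|<\infty$. Both representations are unique. Let $\hat I$ be the set of sequences $x=(Q_0,Q_1,\dots)$ with $Q_0=I$ and $Q_{j+1}\in\mathcal P^{j+1}$ a child of $Q_j$; write $x\in Q_j$ for all $j$. The Dirac mass $\delta_x$ is the limit in $B^{-s}_{1,1}$ of the functionals $\psi\mapsto\frac1{|Q_j|}\int_{Q_j}\psi\,d\mu$. For $x,y\in\hat I$ put $\hat d(x,y)=|P|$ if, for some $n$, $x,y\in P\in\mathcal P^n$ while $x\in Q_1\in\mathcal P^{n+1}$, $y\in Q_2\in\mathcal P^{n+1}$ with $Q_1\ne Q_2$,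 and $\hat d(x,y)=0$ otherwise. **Corollary.** For every $x\in\hat I$ the limit $\delta_x$ exists in $B^{-s}_{1,1}$ and is unique, and there is a constant $C>1$ such that: 1. if $x,y\in\hat I$, $x,y\in P\in\mathcal P^n$, $x\in Q_1\in\mathcal P^{n+1}$, $y\in Q_2\in\mathcal P^{n+1}$ and $Q_1\neq Q_2$, then $\frac1C|P|^s\le|\delta_x-\delta_y|_{B^{-s}_{1,1}}\le C|P|^s$; 2. for all $x,y\in\hat I$, $\frac1C\hat d(x,y)^s\le|\delta_x-\delta_y|_{B^{-s}_{1,1}}\le C\,\hat d(x,y)^s$. -/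

import Mathlib

open MeasureTheory Filter Topology
open scoped ENNReal

noncomputable section

namespace GridBesov

/-- A good grid on a measure space: a nested sequence of finite measurable partitions
(up to sets of measure zero), with comparable sizes of fathers and children. -/
structure GoodGrid {I : Type*} [mI : MeasurableSpace I] (μ : Measure I) where
  /-- `parts k` is the partition of level `k`. -/
  parts : ℕ → Finset (Set I)
  measurable : ∀ k, ∀ Q ∈ parts k, MeasurableSet Q
  aedisjoint : ∀ k, ∀ Q ∈ parts k, ∀ R ∈ parts k, Q ≠ R → AEDisjoint μ Q R
  cover : ∀ k, μ (⋃ Q ∈ parts k, Q)ᶜ = 0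
  parts_zero : parts 0 = {Set.univ}
  nested : ∀ k, ∀ Q ∈ parts (k + 1), ∃ P ∈ parts k, Q ⊆ P
  ratio : ∃ lamStar ∈ Set.Ioo (0 : ℝ) 1, ∃ lam ∈ Set.Ioo (0 : ℝ) 1,
    ∀ k, ∀ Q ∈ parts (k + 1), ∀ P ∈ parts k, Q ⊆ P →
      lamStar ≤ μ.real Q / μ.real P ∧ μ.real Q / μ.real P ≤ lam
  generates : MeasurableSpace.generateFrom (⋃ k, (parts k : Set (Set I))) = mI

/-- A choice, for each cell `Q` of level `k`, of a total order of the set of its children,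
given as the list of the children in increasing order. -/
structure ChildOrder {I : Type*} [MeasurableSpace I] {μ : Measure I} (G : GoodGrid μ) where
  children : ℕ → Set I → List (Set I)
  nodup : ∀ k, ∀ Q ∈ G.parts k, (children k Q).Nodup
  mem_iff : ∀ k, ∀ Q ∈ G.parts k, ∀ R, R ∈ children k Q ↔ R ∈ G.parts (k + 1) ∧ R ⊆ Q

/-- The pairs obtained from an ordered list by cutting it at the integer part of half of its
length, and cutting again both halves recursively as long as they have at least two entries. -/
def haarPairs {α : Type*} (l : List α) : List (List α × List α) :=
  if _h : 2 ≤ l.length then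
    (l.take (l.length / 2), l.drop (l.length / 2)) ::
      (haarPairs (l.take (l.length / 2)) ++ haarPairs (l.drop (l.length / 2)))
  else []
termination_by l.length
decreasing_by all_goals (simp only [List.length_take, List.length_drop]; omega)

/-- The unbalanced Haar wavelet of a pair of families of sets. -/
def haarFun {I : Type*} [MeasurableSpace I] (μ : Measure I)
    (p : List (Set I) × List (Set I)) (t : I) : ℂ :=
  (p.1.map fun P => P.indicator (fun _ => (1 : ℂ)) t).sum / (((p.1.map μ.real).sum : ℝ) : ℂ) -
    (p.2.map fun R => R.indicator (fun _ => (1 : ℂ)) t).sum / (((p.2.map μ.real).sum : ℝ) : ℂ)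

section Besov

variable {I : Type*} [MeasurableSpace I] {μ : Measure I} {G : GoodGrid μ}

/-- The index set of the wavelets of level `k`: a cell `Q` of level `k`, and a pair
in the family `H_Q`. -/
abbrev WaveletAt (O : ChildOrder G) (k : ℕ) : Type _ :=
  Σ Q : {Q // Q ∈ G.parts k}, {p // p ∈ haarPairs (O.children k Q.1)}

instance (O : ChildOrder G) (k : ℕ) : Fintype (WaveletAt O k) := by
  classical
  haveI : ∀ Q : {Q // Q ∈ G.parts k}, Fintype {p // p ∈ haarPairs (O.children k Q.1)} :=
    fun Q => Fintype.subtype (haarPairs (O.children k Q.1)).toFinset (by simp)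
  infer_instance

/-- The index set of all wavelets. -/
abbrev Wavelet (O : ChildOrder G) : Type _ := Σ k, WaveletAt O k

/-- The measure `|Q|` of the cell of a wavelet. -/
def Wavelet.size {O : ChildOrder G} (w : Wavelet O) : ℝ := μ.real w.2.1.1

/-- The wavelet as a function. -/
def Wavelet.fn {O : ChildOrder G} (w : Wavelet O) : I → ℂ := haarFun μ w.2.2.1

/-- Partial sums (levels `k < N`) of the Haar series with coefficients `cI` and `|Q|^(1+s) c`. -/
def posPartialSum (O : ChildOrder G) (s : ℝ) (cI : ℂ) (c : Wavelet O → ℂ) (N : ℕ) (t : I) : ℂ :=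
  cI + ∑ k ∈ Finset.range N, ∑ w : WaveletAt O k,
    (((Wavelet.size (O := O) ⟨k, w⟩) ^ (1 + s) : ℝ) : ℂ) * c ⟨k, w⟩ *
      Wavelet.fn (O := O) ⟨k, w⟩ t

/-- `ψ` is the sum in `L^∞` of the Haar series with the bounded coefficients `cI`, `c`. -/
structure IsPosRep (O : ChildOrder G) (s : ℝ) (ψ : Lp ℂ ∞ μ) (cI : ℂ) (c : Wavelet O → ℂ) :
    Prop where
  bdd : BddAbove (Set.range fun w => ‖c w‖)
  tendsto : Tendsto (fun N => eLpNorm (fun t => posPartialSum O s cI c N t - ψ t) ∞ μ)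
    atTop (𝓝 0)

theorem measurable_fn {O : ChildOrder G} (w : Wavelet O) : Measurable w.fn := by
  obtain ⟨k, ⟨Q, hQ⟩, p, hp⟩ := w
  have key : ∀ (l : List (Set I)), ∀ p ∈ haarPairs l, (∀ P ∈ p.1, P ∈ l) ∧ (∀ P ∈ p.2, P ∈ l) := by
    intro l
    induction l using haarPairs.induct with
    | case1 l h ih1 ih2 =>
      intro p hp
      rw [haarPairs, dif_pos h] at hp
      simp only [List.mem_cons, List.mem_append] at hp
      rcases hp with rfl | hp | hp
      · exact ⟨fun P h => List.mem_of_mem_take h, fun P h => List.mem_of_mem_drop h⟩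
      · exact ⟨fun P h => List.mem_of_mem_take ((ih1 p hp).1 P h),
          fun P h => List.mem_of_mem_take ((ih1 p hp).2 P h)⟩
      · exact ⟨fun P h => List.mem_of_mem_drop ((ih2 p hp).1 P h),
          fun P h => List.mem_of_mem_drop ((ih2 p hp).2 P h)⟩
    | case2 l h =>
      intro p hp
      rw [haarPairs, dif_neg h] at hp
      simp at hp
  have hm : ∀ P ∈ O.children k Q, MeasurableSet P := fun P hP =>
    G.measurable (k + 1) P ((O.mem_iff k Q hQ P).1 hP).1
  have hsum : ∀ S : List (Set I), (∀ P ∈ S, MeasurableSet P) →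
      Measurable fun t => (S.map fun P => P.indicator (fun _ => (1 : ℂ)) t).sum := by
    intro S
    induction S with
    | nil => intro _; simp
    | cons P S ih =>
      intro h
      simp only [List.map_cons, List.sum_cons]
      exact (measurable_const.indicator (h P (by simp))).add
        (ih fun R hR => h R (by simp [hR]))
  exact ((hsum _ fun P hP => hm P ((key _ p hp).1 P hP)).div_const _).sub
    ((hsum _ fun P hP => hm P ((key _ p hp).2 P hP)).div_const _)

theorem measurable_posPartialSum (O : ChildOrder G) (s : ℝ) (cI : ℂ) (c : Wavelet O → ℂ)
    (N : ℕ) : Measurable (posPartialSum O s cI c N) := by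
  unfold posPartialSum
  refine measurable_const.add (Finset.measurable_sum _ fun k _ => Finset.measurable_sum _
    fun w _ => ?_)
  exact (measurable_fn _).const_mul _

theorem IsPosRep.add {O : ChildOrder G} {s : ℝ} {ψ ψ' : Lp ℂ ∞ μ} {cI cI' : ℂ}
    {c c' : Wavelet O → ℂ} (h : IsPosRep O s ψ cI c) (h' : IsPosRep O s ψ' cI' c') :
    IsPosRep O s (ψ + ψ') (cI + cI') (c + c') := by
  refine ⟨?_, ?_⟩
  · obtain ⟨B, hB⟩ := h.bdd
    obtain ⟨B', hB'⟩ := h'.bdd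
    refine ⟨B + B', ?_⟩
    rintro _ ⟨w, rfl⟩
    exact (norm_add_le _ _).trans (add_le_add (hB ⟨w, rfl⟩) (hB' ⟨w, rfl⟩))
  · have h0 := h.tendsto.add h'.tendsto
    rw [add_zero] at h0
    refine tendsto_of_tendsto_of_tendsto_of_le_of_le tendsto_const_nhds h0
      (fun _ => zero_le) fun N => ?_
    refine le_trans (le_of_eq ?_) (eLpNorm_add_le
      ((measurable_posPartialSum O s cI c N).aestronglyMeasurable.sub (Lp.aestronglyMeasurable ψ))
      ((measurable_posPartialSum O s cI' c' N).aestronglyMeasurable.sub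
        (Lp.aestronglyMeasurable ψ')) le_top)
    refine eLpNorm_congr_ae ?_
    filter_upwards [Lp.coeFn_add ψ ψ'] with t ht
    simp only [ht, Pi.add_apply, posPartialSum, mul_add, add_mul,
      Finset.sum_add_distrib]
    ring

theorem IsPosRep.smul {O : ChildOrder G} {s : ℝ} {ψ : Lp ℂ ∞ μ} {cI : ℂ}
    {c : Wavelet O → ℂ} (a : ℂ) (h : IsPosRep O s ψ cI c) :
    IsPosRep O s (a • ψ) (a * cI) (a • c) := by
  refine ⟨?_, ?_⟩
  · obtain ⟨B, hB⟩ := h.bdd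
    refine ⟨‖a‖ * B, ?_⟩
    rintro _ ⟨w, rfl⟩
    simp only [Pi.smul_apply, norm_smul]
    exact mul_le_mul_of_nonneg_left (hB ⟨w, rfl⟩) (norm_nonneg a)
  · have h0 := ENNReal.Tendsto.const_mul (a := ‖a‖ₑ) h.tendsto (Or.inr (by simp))
    rw [mul_zero] at h0
    refine h0.congr fun N => ?_
    rw [← eLpNorm_const_smul]
    refine eLpNorm_congr_ae ?_
    filter_upwards [Lp.coeFn_smul a ψ] with t ht
    simp only [ht, Pi.smul_apply, posPartialSum, smul_eq_mul, mul_sub, mul_add, Finset.mul_sum]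
    congr 2
    refine Finset.sum_congr rfl fun k _ => Finset.sum_congr rfl fun w _ => ?_
    ring

/-- The space `B^s_{∞,∞}`, as a linear subspace of `L^∞`. -/
def BesovPos (O : ChildOrder G) (s : ℝ) : Submodule ℂ (Lp ℂ ∞ μ) where
  carrier := {ψ | ∃ cI c, IsPosRep O s ψ cI c}
  add_mem' := by
    rintro ψ ψ' ⟨cI, c, h⟩ ⟨cI', c', h'⟩
    exact ⟨_, _, h.add h'⟩
  zero_mem' := by
    refine ⟨0, 0, ⟨⟨0, by rintro _ ⟨w, rfl⟩; simp⟩, ?_⟩⟩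
    refine tendsto_const_nhds.congr fun N => ?_
    rw [eLpNorm_congr_ae (g := fun _ => (0 : ℂ)), eLpNorm_zero']
    filter_upwards [Lp.coeFn_zero ℂ ∞ μ] with t ht
    rw [ht]
    simp [posPartialSum]
  smul_mem' := by
    rintro a ψ ⟨cI, c, h⟩
    exact ⟨_, _, h.smul a⟩

/-- The norm of `B^s_{∞,∞}`: the value of `|c_I| + sup |c|` for the representation
(the infimum is over a set with one element, since the representation is unique). -/
def posNorm (O : ChildOrder G) (s : ℝ) (ψ : BesovPos O s) : ℝ :=
  sInf {r | ∃ cI c, IsPosRep O s ψ.1 cI c ∧ r = ‖cI‖ + ⨆ w, ‖c w‖}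

theorem posNorm_nonneg (O : ChildOrder G) (s : ℝ) (ψ : BesovPos O s) : 0 ≤ posNorm O s ψ := by
  refine Real.sInf_nonneg ?_
  rintro _ ⟨cI, c, -, rfl⟩
  exact add_nonneg (norm_nonneg _) (Real.iSup_nonneg fun _ => norm_nonneg _)

/-- `φ` is represented by the Haar series with coefficients `dI` and `|Q|^(-s) d`,
where `d` is absolutely summable. -/
structure IsNegRep (O : ChildOrder G) (s : ℝ) (φ : BesovPos O s →ₗ[ℂ] ℂ)
    (dI : ℂ) (d : Wavelet O → ℂ) : Prop where
  summable : Summable fun w => ‖d w‖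
  tendsto : ∀ ψ : BesovPos O s, Tendsto (fun N : ℕ =>
      dI * ∫ t, ψ.1 t ∂μ + ∑ k ∈ Finset.range N, ∑ w : WaveletAt O k,
        d ⟨k, w⟩ * (((Wavelet.size (O := O) ⟨k, w⟩) ^ (-s) : ℝ) : ℂ) *
          ∫ t, ψ.1 t * Wavelet.fn (O := O) ⟨k, w⟩ t ∂μ)
    atTop (𝓝 (φ ψ))

/-- The space `B^{-s}_{1,1}`: the linear functionals on `B^s_{∞,∞}` which are continuous
and have a Haar series with absolutely summable coefficients. -/
def BesovNeg (O : ChildOrder G) (s : ℝ) : Submodule ℂ (BesovPos O s →ₗ[ℂ] ℂ) where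
  carrier := {φ | (∃ K : ℝ, ∀ ψ, ‖φ ψ‖ ≤ K * posNorm O s ψ) ∧ ∃ dI d, IsNegRep O s φ dI d}
  add_mem' := by
    rintro φ φ' ⟨⟨K, hK⟩, dI, d, h⟩ ⟨⟨K', hK'⟩, dI', d', h'⟩
    refine ⟨⟨K + K', fun ψ => ?_⟩, dI + dI', d + d', ⟨?_, fun ψ => ?_⟩⟩
    · rw [add_mul]
      exact (norm_add_le _ _).trans (add_le_add (hK ψ) (hK' ψ))
    · exact Summable.of_nonneg_of_le (fun _ => norm_nonneg _) (fun w => norm_add_le _ _)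
        (h.summable.add h'.summable)
    · refine ((h.tendsto ψ).add (h'.tendsto ψ)).congr fun N => ?_
      simp only [Pi.add_apply, add_mul, Finset.sum_add_distrib]
      ring
  zero_mem' := by
    refine ⟨⟨0, fun ψ => by simp⟩, 0, 0, ⟨by simp, fun ψ => by simp⟩⟩
  smul_mem' := by
    rintro a φ ⟨⟨K, hK⟩, dI, d, h⟩
    refine ⟨⟨‖a‖ * K, fun ψ => ?_⟩, a * dI, a • d, ⟨?_, fun ψ => ?_⟩⟩
    · rw [LinearMap.smul_apply, norm_smul, mul_assoc]
      exact mul_le_mul_of_nonneg_left (hK ψ) (norm_nonneg a)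
    · simp only [Pi.smul_apply, norm_smul]
      exact h.summable.mul_left _
    · rw [LinearMap.smul_apply]
      refine ((h.tendsto ψ).const_smul a).congr fun N => ?_
      simp only [Pi.smul_apply, smul_eq_mul, mul_add, Finset.mul_sum, mul_assoc]

/-- The norm of `B^{-s}_{1,1}`: the value of `|d_I| + ∑ |d|` for the representation
(the infimum is over a set with one element, since the representation is unique). -/
def negNorm (O : ChildOrder G) (s : ℝ) (φ : BesovNeg O s) : ℝ :=
  sInf {r | ∃ dI d, IsNegRep O s φ.1 dI d ∧ r = ‖dI‖ + ∑' w, ‖d w‖}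

/-- The functional `ψ ↦ ∫ ψ (1_Q / |Q|) dμ` on `B^s_{∞,∞}`. -/
def cellAverage [IsFiniteMeasure μ] (O : ChildOrder G) (s : ℝ) (Q : Set I) :
    BesovPos O s →ₗ[ℂ] ℂ where
  toFun ψ := ((μ.real Q : ℝ) : ℂ)⁻¹ * ∫ t in Q, ψ.1 t ∂μ
  map_add' ψ ψ' := by
    have hi : ∀ f : Lp ℂ ∞ μ, Integrable f (μ.restrict Q) := fun f =>
      ((Lp.memLp f).integrable le_top).restrict
    rw [← mul_add, ← integral_add (hi _) (hi _)]
    congr 1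
    exact integral_congr_ae (ae_restrict_of_ae (Lp.coeFn_add ψ.1 ψ'.1))
  map_smul' a ψ := by
    rw [RingHom.id_apply, smul_eq_mul, mul_left_comm]
    congr 1
    rw [← integral_const_mul]
    exact integral_congr_ae (ae_restrict_of_ae (Lp.coeFn_smul a ψ.1))

/-- The space `Î`: sequences `I = Q_0, Q_1, Q_2, …` where `Q_{j+1}` is a child of `Q_j`. -/
@[ext] structure HatPoint (G : GoodGrid μ) where
  cell : ℕ → Set I
  mem : ∀ j, cell j ∈ G.parts j
  subset : ∀ j, cell (j + 1) ⊆ cell j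

/-- `δ` is the Dirac mass of `x = (Q_j)`: the limit of `1_{Q_j} / |Q_j|` in `B^{-s}_{1,1}`. -/
def IsDirac [IsFiniteMeasure μ] (O : ChildOrder G) (s : ℝ) (x : HatPoint G)
    (δ : BesovNeg O s) : Prop :=
  ∃ u : ℕ → BesovNeg O s, (∀ j, (u j).1 = cellAverage O s (x.cell j)) ∧
    Tendsto (fun j => negNorm O s (u j - δ)) atTop (𝓝 0)

open Classical in
/-- The metric of `Î`: `|P|` for the last common cell `P` of `x` and `y`, and `0` if `x` and `y`
have the same cells. -/
def hatDist (x y : HatPoint G) : ℝ :=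
  if h : ∃ n, x.cell n = y.cell n ∧ x.cell (n + 1) ≠ y.cell (n + 1) then
    μ.real (x.cell (Nat.find h))
  else 0

end Besov

end GridBesov

end

open GridBesov

/-! The wavelets are orthogonal, so a functional has only one Haar series (`IsNegRep.unique`) and
the norm of $B^{-s}_{1,1}$ is an $\ell^1$ norm of coefficients (`negNorm_eq`). Everything then
reduces to computing the coefficients of $\delta_x$. If a list of cells is cut into $S_1,S_2$ of
masses $m_1,m_2$, then $1_{S_1}/m_1=1_{S_1\cup S_2}/(m_1+m_2)+\frac{m_2}{m_1+m_2}\phi$, and for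
$S_2$ the factor is $-\frac{m_1}{m_1+m_2}$. Iterating over cuts and levels writes $1_{Q_j}/|Q_j|$ as
$1$ plus wavelets of $Q_0,\dots,Q_{j-1}$ (`cell_indicator_div_eq_sum`); relative to the weight
$|Q|^{-s}$, each coefficient is at most $|Q|^s$ in modulus. A cell has boundedly many wavelets and
$|Q_j|$ decays geometrically, so the coefficients are summable and the truncations converge in norm
(`exists_isDirac`). Let $P$ be the last common cell of $x$ and $y$. The coefficients agree at levels
coarser than $P$, and from $P$ on they are dominated by a geometric series of size $|P|^s$
(`exists_negNorm_dirac_sub_le`). Some wavelet of $P$ has the two points in opposite halves; its two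
coefficients differ by exactly $|P|^s$, which is the lower bound (`le_negNorm_dirac_sub`). -/

noncomputable section

namespace GridBesov

/-! ### Combinatorics of the recursive bisection of a list -/

theorem haarPairs_of_two_le {α : Type*} {l : List α} (h : 2 ≤ l.length) :
    haarPairs l = (l.take (l.length / 2), l.drop (l.length / 2)) ::
      (haarPairs (l.take (l.length / 2)) ++ haarPairs (l.drop (l.length / 2))) := by
  rw [haarPairs, dif_pos h]

theorem haarPairs_of_lt_two {α : Type*} {l : List α} (h : ¬ 2 ≤ l.length) :
    haarPairs l = [] := by
  rw [haarPairs, dif_neg h]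

/-- Induction along the recursive bisection of a list. -/
theorem haarPairs_induction {α : Type*} {motive : List α → Prop}
    (small : ∀ l : List α, l.length < 2 → motive l)
    (append : ∀ l₁ l₂ : List α, l₁ ≠ [] → l₂ ≠ [] →
      haarPairs (l₁ ++ l₂) = (l₁, l₂) :: (haarPairs l₁ ++ haarPairs l₂) →
      motive l₁ → motive l₂ → motive (l₁ ++ l₂)) (l : List α) : motive l := by
  induction l using haarPairs.induct with
  | case1 l h ih1 ih2 =>
    rw [← List.take_append_drop (l.length / 2) l]
    refine append _ _ ?_ ?_ ?_ ih1 ih2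
    · rw [← List.length_pos_iff, List.length_take]; omega
    · rw [← List.length_pos_iff, List.length_drop]; omega
    · rw [List.take_append_drop, haarPairs_of_two_le h]
  | case2 l h => exact small l (by omega)

theorem append_sublist_of_mem_haarPairs {α : Type*} {l : List α} {p : List α × List α}
    (hp : p ∈ haarPairs l) : (p.1 ++ p.2).Sublist l := by
  induction l using haarPairs_induction generalizing p with
  | small l h => rw [haarPairs_of_lt_two (by omega)] at hp; simp at hp
  | append l₁ l₂ _ _ h ih1 ih2 =>
    rw [h, List.mem_cons, List.mem_append] at hp
    rcases hp with rfl | hp | hp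
    · exact List.Sublist.refl _
    · exact (ih1 hp).trans (List.sublist_append_left _ _)
    · exact (ih2 hp).trans (List.sublist_append_right _ _)

theorem ne_nil_of_mem_haarPairs {α : Type*} {l : List α} {p : List α × List α}
    (hp : p ∈ haarPairs l) : p.1 ≠ [] ∧ p.2 ≠ [] := by
  induction l using haarPairs_induction with
  | small l h => rw [haarPairs_of_lt_two (by omega)] at hp; simp at hp
  | append l₁ l₂ h1 h2 h ih1 ih2 =>
    rw [h, List.mem_cons, List.mem_append] at hp
    rcases hp with rfl | hp | hp
    exacts [⟨h1, h2⟩, ih1 hp, ih2 hp]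

theorem mem_of_mem_haarPairs {α : Type*} {l : List α} {p : List α × List α}
    (hp : p ∈ haarPairs l) {a : α} (ha : a ∈ p.1 ∨ a ∈ p.2) : a ∈ l :=
  (append_sublist_of_mem_haarPairs hp).subset (List.mem_append.2 ha)

/-- The cuts are the inner nodes of a binary tree whose leaves are the entries. This is what bounds
the number of wavelets of a cell. -/
theorem length_haarPairs_lt {α : Type*} {l : List α} (hl : l ≠ []) :
    (haarPairs l).length < l.length := by
  induction l using haarPairs_induction with
  | small l h =>
    rw [haarPairs_of_lt_two (by omega)]
    exact List.length_pos_iff.2 hl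
  | append l₁ l₂ h1 h2 h ih1 ih2 =>
    have := ih1 h1
    have := ih2 h2
    rw [h]
    simp only [List.length_cons, List.length_append]
    omega

/-- The support of `p` lies in one half of `q`, or outside `q`. -/
def PairNested {α : Type*} (p q : List α × List α) : Prop :=
  (∀ a, a ∈ p.1 ∨ a ∈ p.2 → a ∈ q.1) ∨ (∀ a, a ∈ p.1 ∨ a ∈ p.2 → a ∈ q.2) ∨
    (∀ a, a ∈ p.1 ∨ a ∈ p.2 → ¬ (a ∈ q.1 ∨ a ∈ q.2))

/-- Each cut is listed before the cuts of its halves, so a later pair lies inside one half of an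
earlier one or comes from a disjoint branch. Orthogonality within one cell rests on this order. -/
theorem pairwise_haarPairs {α : Type*} {l : List α} (hl : l.Nodup) :
    (haarPairs l).Pairwise fun q p => PairNested p q := by
  induction l using haarPairs_induction with
  | small l h => rw [haarPairs_of_lt_two (by omega)]; simp
  | append l₁ l₂ _ _ h ih1 ih2 =>
    rw [h, List.pairwise_cons, List.pairwise_append]
    rw [List.nodup_append'] at hl
    refine ⟨fun p hp => ?_, ih1 hl.1, ih2 hl.2.1, fun q hq p hp => ?_⟩
    · rcases List.mem_append.1 hp with hp | hp
      · exact Or.inl fun a ha => mem_of_mem_haarPairs hp ha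
      · exact Or.inr (Or.inl fun a ha => mem_of_mem_haarPairs hp ha)
    · exact Or.inr (Or.inr fun a ha ha' =>
        hl.2.2 (mem_of_mem_haarPairs hq ha') (mem_of_mem_haarPairs hp ha))

theorem disjoint_of_mem_haarPairs {α : Type*} {l : List α} (hl : l.Nodup)
    {p : List α × List α} (hp : p ∈ haarPairs l) : p.1.Nodup ∧ p.2.Nodup ∧ p.1.Disjoint p.2 :=
  List.nodup_append'.1 (hl.sublist (append_sublist_of_mem_haarPairs hp))

theorem not_pairNested_self {α : Type*} {l : List α} (hl : l.Nodup) {p : List α × List α}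
    (hp : p ∈ haarPairs l) : ¬ PairNested p p := by
  have hd := (disjoint_of_mem_haarPairs hl hp).2.2
  obtain ⟨a, ha⟩ := List.exists_mem_of_ne_nil _ (ne_nil_of_mem_haarPairs hp).1
  obtain ⟨b, hb⟩ := List.exists_mem_of_ne_nil _ (ne_nil_of_mem_haarPairs hp).2
  rintro (h | h | h)
  · exact hd (h b (Or.inr hb)) hb
  · exact hd ha (h a (Or.inl ha))
  · exact h a (Or.inl ha) (Or.inl ha)

theorem nodup_haarPairs {α : Type*} {l : List α} (hl : l.Nodup) : (haarPairs l).Nodup := by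
  refine List.Pairwise.imp_of_mem ?_ (pairwise_haarPairs hl)
  rintro p q hp - h rfl
  exact not_pairNested_self hl hp h

theorem pairNested_or_of_ne {α : Type*} {l : List α} (hl : l.Nodup) {p q : List α × List α}
    (hp : p ∈ haarPairs l) (hq : q ∈ haarPairs l) (hpq : p ≠ q) :
    PairNested p q ∨ PairNested q p := by
  have h : (haarPairs l).Pairwise fun q p => PairNested p q ∨ PairNested q p :=
    (pairwise_haarPairs hl).imp Or.inl
  have : Std.Symm (fun q p : List α × List α => PairNested p q ∨ PairNested q p) :=
    ⟨fun _ _ h => h.symm⟩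
  exact (h.forall hp hq hpq).symm

/-- Follow the half containing both entries until a cut separates them; this ends because the final
pieces have at most one entry. The pair found carries the lower bound. -/
theorem exists_haarPairs_separating {α : Type*} {l : List α} {a b : α} (ha : a ∈ l) (hb : b ∈ l)
    (hab : a ≠ b) : ∃ p ∈ haarPairs l, (a ∈ p.1 ∧ b ∈ p.2) ∨ (b ∈ p.1 ∧ a ∈ p.2) := by
  induction l using haarPairs_induction with
  | small l h =>
    match l, h with
    | [], _ => simp at ha
    | [c], _ => simp at ha hb; exact absurd (ha.trans hb.symm) hab
  | append l₁ l₂ _ _ h ih1 ih2 =>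
    rw [h]
    rcases List.mem_append.1 ha with ha | ha <;> rcases List.mem_append.1 hb with hb | hb
    · obtain ⟨p, hp, h'⟩ := ih1 ha hb
      exact ⟨p, by simp [hp], h'⟩
    · exact ⟨_, List.mem_cons_self, Or.inl ⟨ha, hb⟩⟩
    · exact ⟨_, List.mem_cons_self, Or.inr ⟨hb, ha⟩⟩
    · obtain ⟨p, hp, h'⟩ := ih2 ha hb
      exact ⟨p, by simp [hp], h'⟩

/-! ### Indicator sums, masses, and the Haar expansion inside one list of cells -/

/-- The number of cells of a list which contain a point. -/
def indSum {I : Type*} (S : List (Set I)) (t : I) : ℂ :=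
  (S.map fun P => P.indicator (fun _ => (1 : ℂ)) t).sum

@[simp] theorem indSum_append {I : Type*} (S T : List (Set I)) (t : I) :
    indSum (S ++ T) t = indSum S t + indSum T t := by
  simp [indSum]

open Classical in
theorem indSum_eq_ite {I : Type*} {S : List (Set I)} (hS : S.Nodup) {R : Set I} {t : I} (ht : t ∈ R)
    (hu : ∀ P ∈ S, t ∈ P → P = R) : indSum S t = if R ∈ S then 1 else 0 := by
  induction S with
  | nil => simp [indSum]
  | cons P S ih =>
    have hS' := List.nodup_cons.1 hS
    have h1 : indSum (P :: S) t = P.indicator (fun _ => (1 : ℂ)) t + indSum S t := by simp [indSum]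
    rw [h1, ih hS'.2 fun P hP => hu P (by simp [hP])]
    by_cases hP : t ∈ P
    · have := hu P (by simp) hP
      subst this
      simp [hP, hS'.1]
    · have hne : R ≠ P := by rintro rfl; exact hP ht
      simp [hP, hne]

theorem indSum_eq_zero {I : Type*} {S : List (Set I)} {t : I} (h : ∀ P ∈ S, t ∉ P) :
    indSum S t = 0 := by
  refine List.sum_eq_zero fun x hx => ?_
  obtain ⟨P, hP, rfl⟩ := List.mem_map.1 hx
  simp [h P hP]

section Mass

variable {I : Type*} [MeasurableSpace I] (μ : Measure I)

/-- The total measure of a list of cells. -/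
def mass (S : List (Set I)) : ℝ := (S.map μ.real).sum

theorem haarFun_eq (p : List (Set I) × List (Set I)) (t : I) :
    haarFun μ p t = indSum p.1 t / (mass μ p.1 : ℂ) - indSum p.2 t / (mass μ p.2 : ℂ) := rfl

@[simp] theorem mass_append (S T : List (Set I)) : mass μ (S ++ T) = mass μ S + mass μ T := by
  simp [mass]

theorem mass_nonneg (S : List (Set I)) : 0 ≤ mass μ S :=
  List.sum_nonneg (by simp)

variable {μ} in
theorem le_mass_of_mem {S : List (Set I)} {P : Set I} (hP : P ∈ S) : μ.real P ≤ mass μ S :=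
  List.single_le_sum (by simp) _ (List.mem_map_of_mem hP)

variable {μ} in
theorem mass_pos {S : List (Set I)} (hS : S ≠ []) (h : ∀ P ∈ S, 0 < μ.real P) : 0 < mass μ S := by
  obtain ⟨P, hP⟩ := List.exists_mem_of_ne_nil _ hS
  exact (h P hP).trans_le (le_mass_of_mem hP)

open Classical in
/-- The coefficient of the wavelet of `p` in the Haar expansion of `1_R / |R|`. -/
def haarCoef (p : List (Set I) × List (Set I)) (R : Set I) : ℝ :=
  if R ∈ p.1 then mass μ p.2 / (mass μ p.1 + mass μ p.2)
  else if R ∈ p.2 then - (mass μ p.1 / (mass μ p.1 + mass μ p.2)) else 0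

theorem abs_haarCoef_le_one (p : List (Set I) × List (Set I)) (R : Set I) :
    |haarCoef μ p R| ≤ 1 := by
  have h1 := mass_nonneg μ p.1
  have h2 := mass_nonneg μ p.2
  unfold haarCoef
  split_ifs
  · rw [abs_of_nonneg (by positivity)]
    exact div_le_one_of_le₀ (by linarith) (by positivity)
  · rw [abs_neg, abs_of_nonneg (by positivity)]
    exact div_le_one_of_le₀ (by linarith) (by positivity)
  · simp

variable {μ} in
-- The two coefficients are $m_2/(m_1+m_2)$ and $-m_1/(m_1+m_2)$, so the masses cancel and the lower
-- bound does not depend on the grid constants.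
theorem haarCoef_sub_haarCoef {p : List (Set I) × List (Set I)} {R R' : Set I}
    (h1 : 0 < mass μ p.1) (h2 : 0 < mass μ p.2) (hd : p.1.Disjoint p.2) (hR : R ∈ p.1)
    (hR' : R' ∈ p.2) : haarCoef μ p R - haarCoef μ p R' = 1 := by
  have : R' ∉ p.1 := fun h => hd h hR'
  simp only [haarCoef, hR, this, hR', if_true, if_false]
  field_simp
  ring

variable {μ} in
/-- The Haar expansion of a normalized cell of a list. -/
theorem indicator_div_eq_sum {l : List (Set I)} (hl : l.Nodup) (hpos : ∀ P ∈ l, 0 < μ.real P)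
    {R : Set I} (hR : R ∈ l) (t : I) :
    R.indicator (fun _ => (1 : ℂ)) t / (μ.real R : ℂ) = indSum l t / (mass μ l : ℂ) +
      ((haarPairs l).map fun p => (haarCoef μ p R : ℂ) * haarFun μ p t).sum := by
  induction l using haarPairs_induction with
  | small l h =>
    match l, h with
    | [], _ => simp at hR
    | [c], h =>
      rw [haarPairs_of_lt_two (by omega)]
      simp only [List.mem_singleton] at hR
      simp [indSum, mass, hR]
  | append l₁ l₂ hn1 hn2 h ih1 ih2 =>
    rw [List.nodup_append'] at hl
    have m1 : 0 < mass μ l₁ := mass_pos hn1 fun P hP => hpos P (by simp [hP])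
    have m2 : 0 < mass μ l₂ := mass_pos hn2 fun P hP => hpos P (by simp [hP])
    have c1 : (mass μ l₁ : ℂ) ≠ 0 := by exact_mod_cast m1.ne'
    have c2 : (mass μ l₂ : ℂ) ≠ 0 := by exact_mod_cast m2.ne'
    have c3 : (mass μ l₁ : ℂ) + (mass μ l₂ : ℂ) ≠ 0 := by exact_mod_cast (add_pos m1 m2).ne'
    -- The half that misses `R` contributes nothing, so only one branch of the tree is followed.
    have hz : ∀ l', R ∉ l' →
        ((haarPairs l').map fun p => (haarCoef μ p R : ℂ) * haarFun μ p t).sum = 0 := by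
      intro l' hR'
      refine List.sum_eq_zero fun x hx => ?_
      obtain ⟨p, hp, rfl⟩ := List.mem_map.1 hx
      have h1 : R ∉ p.1 := fun h => hR' (mem_of_mem_haarPairs hp (Or.inl h))
      have h2 : R ∉ p.2 := fun h => hR' (mem_of_mem_haarPairs hp (Or.inr h))
      simp [haarCoef, h1, h2]
    rw [h, List.map_cons, List.sum_cons, List.map_append, List.sum_append, haarFun_eq,
      indSum_append, mass_append]
    rcases List.mem_append.1 hR with hR | hR
    · rw [hz l₂ fun h => hl.2.2 hR h, ih1 hl.1 (fun P hP => hpos P (by simp [hP])) hR]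
      simp only [haarCoef, hR, if_true]
      push_cast
      field_simp
      ring
    · have hR1 : R ∉ l₁ := fun h => hl.2.2 h hR
      rw [hz l₁ hR1, ih2 hl.2.1 (fun P hP => hpos P (by simp [hP])) hR]
      simp only [haarCoef, hR, hR1, if_true, if_false]
      push_cast
      field_simp
      ring

end Mass

/-! ### Cells at regular points, orthogonality of the wavelets, uniform bounds -/

section Grid

variable {I : Type*} [MeasurableSpace I] {μ : Measure I}

theorem GoodGrid.measureReal_pos [IsProbabilityMeasure μ] (G : GoodGrid μ) {k : ℕ} {Q : Set I}
    (hQ : Q ∈ G.parts k) : 0 < μ.real Q := by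
  cases k with
  | zero =>
    rw [G.parts_zero, Finset.mem_singleton] at hQ
    simp [hQ]
  | succ k =>
    obtain ⟨P, hP, hQP⟩ := G.nested k Q hQ
    obtain ⟨a, ha, b, hb, h⟩ := G.ratio
    have h1 := (h k Q hQ P hP hQP).1
    -- A null `Q` makes the quotient $0$ whatever the measure of `P` (even $0/0=0$), against the
    -- lower ratio bound; no induction on the level is needed.
    refine lt_of_le_of_ne measureReal_nonneg fun h0 => ?_
    rw [← h0, zero_div] at h1
    exact absurd ha.1 (not_lt.2 h1)

theorem GoodGrid.exists_superset (G : GoodGrid μ) {k n : ℕ} (hkn : k ≤ n) {Q : Set I}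
    (hQ : Q ∈ G.parts n) : ∃ P ∈ G.parts k, Q ⊆ P := by
  induction n, hkn using Nat.le_induction generalizing Q with
  | base => exact ⟨Q, hQ, subset_rfl⟩
  | succ n _ ih =>
    obtain ⟨R, hR, hQR⟩ := G.nested n Q hQ
    obtain ⟨P, hP, hRP⟩ := ih hR
    exact ⟨P, hP, hQR.trans hRP⟩

/-- Cells of one level may overlap in a null set, but a cell inside both would have positive
measure. -/
theorem GoodGrid.eq_of_subset [IsProbabilityMeasure μ] (G : GoodGrid μ) {k n : ℕ} {P P' Q : Set I}
    (hP : P ∈ G.parts k) (hP' : P' ∈ G.parts k) (hQ : Q ∈ G.parts n) (h : Q ⊆ P)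
    (h' : Q ⊆ P') : P = P' := by
  by_contra hne
  have h0 : μ (P ∩ P') = 0 := G.aedisjoint k P hP P' hP' hne
  have h1 : μ Q = 0 := measure_mono_null (Set.subset_inter h h') h0
  have := G.measureReal_pos hQ
  rw [measureReal_def, h1] at this
  simp at this

/-- The point `t` lies in exactly one cell of each level. -/
def GoodGrid.IsRegular (G : GoodGrid μ) (t : I) : Prop :=
  ∀ k, (∃ Q ∈ G.parts k, t ∈ Q) ∧ ∀ Q ∈ G.parts k, ∀ R ∈ G.parts k, t ∈ Q → t ∈ R → Q = R

theorem GoodGrid.ae_isRegular (G : GoodGrid μ) : ∀ᵐ t ∂μ, G.IsRegular t := by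
  refine ae_all_iff.2 fun k => Filter.Eventually.and ?_ ?_
  · filter_upwards [(mem_ae_iff.2 (G.cover k) : (⋃ Q ∈ G.parts k, Q) ∈ ae μ)] with t ht
    simpa using ht
  · refine (Filter.eventually_all_finset (G.parts k)).2 fun Q hQ =>
      (Filter.eventually_all_finset (G.parts k)).2 fun R hR => ?_
    by_cases h : Q = R
    · exact Eventually.of_forall fun _ _ _ => h
    · have h0 : μ (Q ∩ R) = 0 := G.aedisjoint k Q hQ R hR h
      filter_upwards [measure_eq_zero_iff_ae_notMem.1 h0] with t ht h1 h2
      exact absurd ⟨h1, h2⟩ ht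

open Classical in
/-- The value of a wavelet on a cell. -/
def haarVal (μ : Measure I) (p : List (Set I) × List (Set I)) (R : Set I) : ℂ :=
  if R ∈ p.1 then 1 / (mass μ p.1 : ℂ) else if R ∈ p.2 then -(1 / (mass μ p.2 : ℂ)) else 0

theorem GoodGrid.measureReal_bounds (G : GoodGrid μ) [IsProbabilityMeasure μ] :
    ∃ a ∈ Set.Ioo (0 : ℝ) 1, ∃ b ∈ Set.Ioo (0 : ℝ) 1, ∀ k, ∀ P ∈ G.parts k,
      ∀ Q ∈ G.parts (k + 1), Q ⊆ P → a * μ.real P ≤ μ.real Q ∧ μ.real Q ≤ b * μ.real P := by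
  obtain ⟨a, ha, b, hb, h⟩ := G.ratio
  refine ⟨a, ha, b, hb, fun k P hP Q hQ hQP => ?_⟩
  have hp := G.measureReal_pos hP
  have h1 := h k Q hQ P hP hQP
  exact ⟨(le_div_iff₀ hp).1 h1.1, (div_le_iff₀ hp).1 h1.2⟩

variable {G : GoodGrid μ} (O : ChildOrder G)

theorem haarFun_eq_haarVal {k : ℕ} {Q : Set I} (hQ : Q ∈ G.parts k)
    {p : List (Set I) × List (Set I)} (hp : p ∈ haarPairs (O.children k Q)) {t : I}
    (ht : G.IsRegular t) {R : Set I} (hR : R ∈ G.parts (k + 1)) (htR : t ∈ R) :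
    haarFun μ p t = haarVal μ p R := by
  obtain ⟨n1, n2, hd⟩ := disjoint_of_mem_haarPairs (O.nodup k Q hQ) hp
  have hu : ∀ P, P ∈ p.1 ∨ P ∈ p.2 → t ∈ P → P = R := fun P hP htP =>
    (ht (k + 1)).2 P ((O.mem_iff k Q hQ P).1 (mem_of_mem_haarPairs hp hP)).1 R hR htP htR
  rw [haarFun_eq, indSum_eq_ite n1 htR fun P hP => hu P (Or.inl hP),
    indSum_eq_ite n2 htR fun P hP => hu P (Or.inr hP), haarVal]
  by_cases h1 : R ∈ p.1
  · have h2 : R ∉ p.2 := fun h => hd h1 h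
    simp [h1, h2]
  · by_cases h2 : R ∈ p.2 <;> simp [h1, h2]

theorem indSum_children {k : ℕ} {Q : Set I} (hQ : Q ∈ G.parts k) {t : I} (ht : G.IsRegular t) :
    indSum (O.children k Q) t = Q.indicator (fun _ => (1 : ℂ)) t := by
  obtain ⟨R, hR, htR⟩ := (ht (k + 1)).1
  obtain ⟨P, hP, hRP⟩ := G.nested k R hR
  rw [indSum_eq_ite (O.nodup k Q hQ) htR fun P hP htP =>
    (ht (k + 1)).2 P ((O.mem_iff k Q hQ P).1 hP).1 R hR htP htR]
  have hmem := O.mem_iff k Q hQ R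
  by_cases h : t ∈ Q
  · have : P = Q := (ht k).2 P hP Q hQ (hRP htR) h
    subst this
    simp [hmem, h, hR, hRP]
  · have : ¬ R ⊆ Q := fun h' => h (h' htR)
    simp [hmem, h, this]

theorem integrable_indSum [IsFiniteMeasure μ] {S : List (Set I)} (hS : ∀ P ∈ S, MeasurableSet P) :
    Integrable (indSum S) μ ∧ ∫ t, indSum S t ∂μ = (mass μ S : ℂ) := by
  induction S with
  | nil =>
    have h : indSum ([] : List (Set I)) = fun _ => 0 := by funext t; simp [indSum]
    rw [h]
    simp [mass]
  | cons P S ih =>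
    have ih := ih fun P hP => hS P (by simp [hP])
    have h1 : indSum (P :: S) = fun t => P.indicator (fun _ => (1 : ℂ)) t + indSum S t := by
      funext t; simp [indSum]
    have hi : Integrable (P.indicator fun _ => (1 : ℂ)) μ :=
      (integrable_const _).indicator (hS P (by simp))
    rw [h1]
    refine ⟨hi.add ih.1, ?_⟩
    rw [integral_add hi ih.1, ih.2, integral_indicator (hS P (by simp))]
    simp [mass]

theorem measurableSet_of_mem_children {k : ℕ} {Q : Set I} (hQ : Q ∈ G.parts k) {P : Set I}
    (hP : P ∈ O.children k Q) : MeasurableSet P :=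
  G.measurable (k + 1) P ((O.mem_iff k Q hQ P).1 hP).1

/-- Children may overlap and miss null sets, so additivity is obtained by integrating the almost
everywhere identity `indSum_children`. -/
theorem mass_children [IsProbabilityMeasure μ] {k : ℕ} {Q : Set I} (hQ : Q ∈ G.parts k) :
    mass μ (O.children k Q) = μ.real Q := by
  have h := (integrable_indSum (μ := μ) fun P hP => measurableSet_of_mem_children O hQ hP).2
  rw [integral_congr_ae (G.ae_isRegular.mono fun t ht => indSum_children O hQ ht),
    integral_indicator (G.measurable k Q hQ)] at h
  simp only [integral_const, mul_one, Complex.real_smul,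
    measureReal_restrict_apply_univ] at h
  exact_mod_cast h.symm

theorem mass_pos_of_mem_haarPairs [IsProbabilityMeasure μ] {k : ℕ} {Q : Set I}
    (hQ : Q ∈ G.parts k) {p : List (Set I) × List (Set I)}
    (hp : p ∈ haarPairs (O.children k Q)) : 0 < mass μ p.1 ∧ 0 < mass μ p.2 := by
  have h : ∀ P, P ∈ p.1 ∨ P ∈ p.2 → 0 < μ.real P := fun P hP =>
    G.measureReal_pos ((O.mem_iff k Q hQ P).1 (mem_of_mem_haarPairs hp hP)).1
  exact ⟨mass_pos (ne_nil_of_mem_haarPairs hp).1 fun P hP => h P (Or.inl hP),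
    mass_pos (ne_nil_of_mem_haarPairs hp).2 fun P hP => h P (Or.inr hP)⟩

/-- Testing a wavelet against a function which is constant on each of its two halves. -/
theorem integral_mul_haarFun [IsProbabilityMeasure μ] {k : ℕ} {Q : Set I} (hQ : Q ∈ G.parts k)
    {p : List (Set I) × List (Set I)} (hp : p ∈ haarPairs (O.children k Q)) {g : I → ℂ}
    {c₁ c₂ : ℂ} (hg : ∀ t, G.IsRegular t →
      (∀ P ∈ p.1, t ∈ P → g t = c₁) ∧ ∀ P ∈ p.2, t ∈ P → g t = c₂) :
    ∫ t, g t * haarFun μ p t ∂μ = c₁ - c₂ := by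
  obtain ⟨m1, m2⟩ := mass_pos_of_mem_haarPairs O hQ hp
  have n1 : (mass μ p.1 : ℂ) ≠ 0 := by exact_mod_cast m1.ne'
  have n2 : (mass μ p.2 : ℂ) ≠ 0 := by exact_mod_cast m2.ne'
  have hm : ∀ P, P ∈ p.1 ∨ P ∈ p.2 → MeasurableSet P := fun P hP =>
    measurableSet_of_mem_children O hQ (mem_of_mem_haarPairs hp hP)
  have i1 := integrable_indSum (μ := μ) fun P hP => hm P (Or.inl hP)
  have i2 := integrable_indSum (μ := μ) fun P hP => hm P (Or.inr hP)
  have key : ∀ (S : List (Set I)) (c : ℂ) (t : I), (∀ P ∈ S, t ∈ P → g t = c) →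
      g t * indSum S t = c * indSum S t := by
    intro S c t h
    by_cases hS : ∃ P ∈ S, t ∈ P
    · obtain ⟨P, hP, htP⟩ := hS
      rw [h P hP htP]
    · push Not at hS
      simp [indSum_eq_zero hS]
  have h : ∫ t, g t * haarFun μ p t ∂μ = ∫ t, (c₁ / (mass μ p.1 : ℂ) * indSum p.1 t -
      c₂ / (mass μ p.2 : ℂ) * indSum p.2 t) ∂μ := by
    refine integral_congr_ae (G.ae_isRegular.mono fun t ht => ?_)
    have k1 := key _ _ t (hg t ht).1
    have k2 := key _ _ t (hg t ht).2
    simp only [haarFun_eq, mul_sub, mul_div_assoc', k1, k2]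
    ring
  rw [h, integral_sub (i1.1.const_mul _) (i2.1.const_mul _), integral_const_mul,
    integral_const_mul, i1.2, i2.2]
  field_simp

theorem integral_haarFun [IsProbabilityMeasure μ] {k : ℕ} {Q : Set I} (hQ : Q ∈ G.parts k)
    {p : List (Set I) × List (Set I)} (hp : p ∈ haarPairs (O.children k Q)) :
    ∫ t, haarFun μ p t ∂μ = 0 := by
  have := integral_mul_haarFun O hQ hp (g := fun _ => 1) (c₁ := 1) (c₂ := 1) (by simp)
  simpa using this

theorem integral_haarFun_mul_self [IsProbabilityMeasure μ] {k : ℕ} {Q : Set I}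
    (hQ : Q ∈ G.parts k) {p : List (Set I) × List (Set I)}
    (hp : p ∈ haarPairs (O.children k Q)) :
    ∫ t, haarFun μ p t * haarFun μ p t ∂μ = ((1 / mass μ p.1 + 1 / mass μ p.2 : ℝ) : ℂ) := by
  rw [integral_mul_haarFun O hQ hp (c₁ := 1 / (mass μ p.1 : ℂ)) (c₂ := -(1 / (mass μ p.2 : ℂ)))]
  · push_cast; ring
  · intro t ht
    have hR : ∀ P, P ∈ p.1 ∨ P ∈ p.2 → P ∈ G.parts (k + 1) := fun P hP =>
      ((O.mem_iff k Q hQ P).1 (mem_of_mem_haarPairs hp hP)).1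
    refine ⟨fun P hP htP => ?_, fun P hP htP => ?_⟩
    · rw [haarFun_eq_haarVal O hQ hp ht (hR P (Or.inl hP)) htP, haarVal, if_pos hP]
    · rw [haarFun_eq_haarVal O hQ hp ht (hR P (Or.inr hP)) htP, haarVal, if_neg, if_pos hP]
      exact fun h => (disjoint_of_mem_haarPairs (O.nodup k Q hQ) hp).2.2 h hP

/-- The coarser wavelet is constant on the cell of the finer one, which has mean zero. -/
theorem integral_haarFun_mul_of_lt [IsProbabilityMeasure μ] {k k' : ℕ} (hk : k < k')
    {Q Q' : Set I} (hQ : Q ∈ G.parts k) (hQ' : Q' ∈ G.parts k')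
    {p p' : List (Set I) × List (Set I)} (hp : p ∈ haarPairs (O.children k Q))
    (hp' : p' ∈ haarPairs (O.children k' Q')) :
    ∫ t, haarFun μ p t * haarFun μ p' t ∂μ = 0 := by
  obtain ⟨R, hR, hQR⟩ := G.exists_superset (Nat.succ_le_of_lt hk) hQ'
  have h : ∀ t, G.IsRegular t → ∀ P, P ∈ p'.1 ∨ P ∈ p'.2 → t ∈ P →
      haarFun μ p t = haarVal μ p R := fun t ht P hP htP =>
    haarFun_eq_haarVal O hQ hp ht hR
      (hQR (((O.mem_iff k' Q' hQ' P).1 (mem_of_mem_haarPairs hp' hP)).2 htP))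
  rw [integral_mul_haarFun O hQ' hp' (c₁ := haarVal μ p R) (c₂ := haarVal μ p R), sub_self]
  exact fun t ht => ⟨fun P hP => h t ht P (Or.inl hP), fun P hP => h t ht P (Or.inr hP)⟩

theorem integral_haarFun_mul_of_ne [IsProbabilityMeasure μ] {k : ℕ} {Q Q' : Set I} (hne : Q ≠ Q')
    (hQ : Q ∈ G.parts k) (hQ' : Q' ∈ G.parts k)
    {p p' : List (Set I) × List (Set I)} (hp : p ∈ haarPairs (O.children k Q))
    (hp' : p' ∈ haarPairs (O.children k Q')) :
    ∫ t, haarFun μ p t * haarFun μ p' t ∂μ = 0 := by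
  have h : ∀ t, G.IsRegular t → ∀ P, P ∈ p'.1 ∨ P ∈ p'.2 → t ∈ P → haarFun μ p t = 0 := by
    intro t ht P hP htP
    have hP' := (O.mem_iff k Q' hQ' P).1 (mem_of_mem_haarPairs hp' hP)
    have hn : ¬ (P ∈ p.1 ∨ P ∈ p.2) := fun h => hne ((ht k).2 Q hQ Q' hQ'
      (((O.mem_iff k Q hQ P).1 (mem_of_mem_haarPairs hp h)).2 htP) (hP'.2 htP))
    rw [not_or] at hn
    rw [haarFun_eq_haarVal O hQ hp ht hP'.1 htP, haarVal, if_neg hn.1, if_neg hn.2]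
  rw [integral_mul_haarFun O hQ' hp' (c₁ := 0) (c₂ := 0), sub_self]
  exact fun t ht => ⟨fun P hP => h t ht P (Or.inl hP), fun P hP => h t ht P (Or.inr hP)⟩

theorem integral_haarFun_mul_of_pairNested [IsProbabilityMeasure μ] {k : ℕ} {Q : Set I}
    (hQ : Q ∈ G.parts k) {p p' : List (Set I) × List (Set I)}
    (hp : p ∈ haarPairs (O.children k Q)) (hp' : p' ∈ haarPairs (O.children k Q))
    (hn : PairNested p' p) : ∫ t, haarFun μ p t * haarFun μ p' t ∂μ = 0 := by
  have hd := (disjoint_of_mem_haarPairs (O.nodup k Q hQ) hp).2.2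
  obtain ⟨c, hc⟩ : ∃ c, ∀ P, P ∈ p'.1 ∨ P ∈ p'.2 → haarVal μ p P = c := by
    rcases hn with h | h | h
    · exact ⟨_, fun P hP => if_pos (h P hP)⟩
    · refine ⟨-(1 / (mass μ p.2 : ℂ)), fun P hP => ?_⟩
      rw [haarVal, if_neg fun h' => hd h' (h P hP), if_pos (h P hP)]
    · refine ⟨0, fun P hP => ?_⟩
      have := h P hP
      rw [not_or] at this
      rw [haarVal, if_neg this.1, if_neg this.2]
  have h : ∀ t, G.IsRegular t → ∀ P, P ∈ p'.1 ∨ P ∈ p'.2 → t ∈ P → haarFun μ p t = c :=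
    fun t ht P hP htP => by
      rw [haarFun_eq_haarVal O hQ hp ht
        ((O.mem_iff k Q hQ P).1 (mem_of_mem_haarPairs hp' hP)).1 htP, hc P hP]
  rw [integral_mul_haarFun O hQ hp' (c₁ := c) (c₂ := c), sub_self]
  exact fun t ht => ⟨fun P hP => h t ht P (Or.inl hP), fun P hP => h t ht P (Or.inr hP)⟩

variable {O}

theorem integral_fn [IsProbabilityMeasure μ] (w : Wavelet O) : ∫ t, w.fn t ∂μ = 0 :=
  integral_haarFun O w.2.1.2 w.2.2.2

/-- The wavelets are orthogonal. -/
theorem integral_fn_mul_fn [IsProbabilityMeasure μ] {w w' : Wavelet O} (h : w ≠ w') :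
    ∫ t, w.fn t * w'.fn t ∂μ = 0 := by
  obtain ⟨k, ⟨Q, hQ⟩, p, hp⟩ := w
  obtain ⟨k', ⟨Q', hQ'⟩, p', hp'⟩ := w'
  change ∫ t, haarFun μ p t * haarFun μ p' t ∂μ = 0
  rcases lt_trichotomy k k' with hk | rfl | hk
  · exact integral_haarFun_mul_of_lt O hk hQ hQ' hp hp'
  · by_cases hQQ : Q = Q'
    · subst hQQ
      have hpp : p ≠ p' := by rintro rfl; exact h rfl
      rcases pairNested_or_of_ne (O.nodup k Q hQ) hp hp' hpp with hn | hn
      · simp only [mul_comm (haarFun μ p _)]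
        exact integral_haarFun_mul_of_pairNested O hQ hp' hp hn
      · exact integral_haarFun_mul_of_pairNested O hQ hp hp' hn
    · exact integral_haarFun_mul_of_ne O hQQ hQ hQ' hp hp'
  · simp only [mul_comm (haarFun μ p _)]
    exact integral_haarFun_mul_of_lt O hk hQ' hQ hp' hp

/-- The square of the `L²` norm of a wavelet. -/
def Wavelet.energy (w : Wavelet O) : ℝ := 1 / mass μ w.2.2.1.1 + 1 / mass μ w.2.2.1.2

theorem integral_fn_mul_self [IsProbabilityMeasure μ] (w : Wavelet O) :
    ∫ t, w.fn t * w.fn t ∂μ = (w.energy : ℂ) :=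
  integral_haarFun_mul_self O w.2.1.2 w.2.2.2

theorem energy_pos [IsProbabilityMeasure μ] (w : Wavelet O) : 0 < w.energy := by
  obtain ⟨h1, h2⟩ := mass_pos_of_mem_haarPairs O w.2.1.2 w.2.2.2
  unfold Wavelet.energy
  positivity

theorem size_pos [IsProbabilityMeasure μ] (w : Wavelet O) : 0 < w.size :=
  G.measureReal_pos w.2.1.2

variable (O) in
-- Each half contains a child, of measure at least $a|Q|$, so each reciprocal mass is at most
-- $1/(a|Q|)$.
theorem exists_size_mul_energy_le [IsProbabilityMeasure μ] :
    ∃ B : ℝ, 0 ≤ B ∧ ∀ w : Wavelet O, w.size * w.energy ≤ B := by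
  obtain ⟨a, ha, b, hb, h⟩ := G.measureReal_bounds
  refine ⟨1 / a + 1 / a, by have := ha.1; positivity, fun w => ?_⟩
  obtain ⟨k, ⟨Q, hQ⟩, p, hp⟩ := w
  change μ.real Q * (1 / mass μ p.1 + 1 / mass μ p.2) ≤ _
  obtain ⟨h1, h2⟩ := mass_pos_of_mem_haarPairs O hQ hp
  have key : ∀ P, P ∈ p.1 ∨ P ∈ p.2 → a * μ.real Q ≤ μ.real P := fun P hP => by
    have hP' := (O.mem_iff k Q hQ P).1 (mem_of_mem_haarPairs hp hP)
    exact (h k Q hQ P hP'.1 hP'.2).1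
  obtain ⟨P, hP⟩ := List.exists_mem_of_ne_nil _ (ne_nil_of_mem_haarPairs hp).1
  obtain ⟨R, hR⟩ := List.exists_mem_of_ne_nil _ (ne_nil_of_mem_haarPairs hp).2
  have k1 := (key P (Or.inl hP)).trans (le_mass_of_mem hP)
  have k2 := (key R (Or.inr hR)).trans (le_mass_of_mem hR)
  have ha0 := ha.1
  rw [mul_add, mul_one_div, mul_one_div]
  refine add_le_add ?_ ?_ <;> rw [div_le_div_iff₀ (by assumption) ha0] <;> linarith

variable (O) in
/-- A uniform bound for the number of wavelets of a cell. -/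
theorem exists_length_haarPairs_le [IsProbabilityMeasure μ] :
    ∃ B : ℝ, 0 ≤ B ∧ ∀ k, ∀ Q ∈ G.parts k, ((haarPairs (O.children k Q)).length : ℝ) ≤ B := by
  obtain ⟨a, ha, b, hb, h⟩ := G.measureReal_bounds
  have ha0 := ha.1
  refine ⟨1 / a, by positivity, fun k Q hQ => ?_⟩
  have hpos := G.measureReal_pos hQ
  -- Every child has measure at least $a|Q|$ and they add up to $|Q|$, so there are at most $1/a$ of
  -- them.
  have h1 : ((O.children k Q).map μ.real).length • (a * μ.real Q) ≤
      ((O.children k Q).map μ.real).sum := by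
    refine List.card_nsmul_le_sum _ _ fun x hx => ?_
    obtain ⟨P, hP, rfl⟩ := List.mem_map.1 hx
    have hP' := (O.mem_iff k Q hQ P).1 hP
    exact (h k Q hQ P hP'.1 hP'.2).1
  change _ ≤ mass μ _ at h1
  rw [mass_children O hQ, List.length_map, nsmul_eq_mul] at h1
  have hne : O.children k Q ≠ [] := by
    intro h0
    have := mass_children O hQ
    rw [h0] at this
    simp [mass] at this
    linarith
  have h2 : ((haarPairs (O.children k Q)).length : ℝ) ≤ (O.children k Q).length := by
    exact_mod_cast (length_haarPairs_lt hne).le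
  refine h2.trans ((le_div_iff₀ ha0).2 ?_)
  by_contra hcon
  push Not at hcon
  nlinarith

end Grid

/-! ### Pairing of the two spaces, uniqueness of coefficients, the norm as an $\ell^1$ norm -/

section Duality

variable {I : Type*} [MeasurableSpace I] {μ : Measure I}
  {G : GoodGrid μ} {O : ChildOrder G} {s : ℝ}

theorem tendsto_sum_wavelet {f : Wavelet O → ℂ} (hf : Summable f) :
    Tendsto (fun N => ∑ k ∈ Finset.range N, ∑ w : WaveletAt O k, f ⟨k, w⟩) atTop
      (𝓝 (∑' w, f w)) :=
  (hf.hasSum.sigma fun _ => hasSum_fintype _).tendsto_sum_nat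

theorem IsNegRep.sub {φ φ' : BesovPos O s →ₗ[ℂ] ℂ} {dI dI' : ℂ} {d d' : Wavelet O → ℂ}
    (h : IsNegRep O s φ dI d) (h' : IsNegRep O s φ' dI' d') :
    IsNegRep O s (φ - φ') (dI - dI') (d - d') := by
  refine ⟨Summable.of_nonneg_of_le (fun _ => norm_nonneg _) (fun w => norm_sub_le _ _)
    (h.summable.add h'.summable), fun ψ => ?_⟩
  refine ((h.tendsto ψ).sub (h'.tendsto ψ)).congr fun N => ?_
  simp only [Pi.sub_apply, sub_mul, Finset.sum_sub_distrib]
  ring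

theorem fn_bounded (w : Wavelet O) : ∃ B : ℝ, ∀ t, ‖w.fn t‖ ≤ B := by
  have hS : ∀ (S : List (Set I)) t, ‖indSum S t‖ ≤ S.length := by
    intro S t
    induction S with
    | nil => simp [indSum]
    | cons P S ih =>
      have h1 : indSum (P :: S) t = P.indicator (fun _ => (1 : ℂ)) t + indSum S t := by
        simp [indSum]
      rw [h1]
      refine (norm_add_le _ _).trans ?_
      have h2 : ‖P.indicator (fun _ => (1 : ℂ)) t‖ ≤ 1 := by
        by_cases h : t ∈ P <;> simp [h]
      push_cast [List.length_cons]
      linarith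
  refine ⟨(w.2.2.1.1.length : ℝ) / ‖(mass μ w.2.2.1.1 : ℂ)‖ +
    (w.2.2.1.2.length : ℝ) / ‖(mass μ w.2.2.1.2 : ℂ)‖, fun t => ?_⟩
  change ‖haarFun μ w.2.2.1 t‖ ≤ _
  rw [haarFun_eq]
  refine (norm_sub_le _ _).trans ?_
  rw [norm_div, norm_div]
  exact add_le_add (div_le_div_of_nonneg_right (hS _ t) (norm_nonneg _))
    (div_le_div_of_nonneg_right (hS _ t) (norm_nonneg _))

theorem memLp_fn (w : Wavelet O) : MemLp w.fn ∞ μ := by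
  obtain ⟨B, hB⟩ := fn_bounded w
  exact memLp_top_of_bound (measurable_fn w).aestronglyMeasurable B (Eventually.of_forall hB)

variable [IsProbabilityMeasure μ]

theorem integrable_fn_mul {g : I → ℂ} (w : Wavelet O) (hg : MemLp g ∞ μ) :
    Integrable (fun t => w.fn t * g t) μ :=
  ((hg.mul (p := ∞) (q := ∞) (r := ∞) (memLp_fn w))).integrable le_top

theorem tendsto_integral_mul_of_eLpNorm {f : ℕ → I → ℂ} {ψ g : I → ℂ}
    (hf : ∀ N, MemLp (f N) ∞ μ) (hψ : MemLp ψ ∞ μ) (hg : MemLp g ∞ μ)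
    (h : Tendsto (fun N => eLpNorm (fun t => f N t - ψ t) ∞ μ) atTop (𝓝 0)) :
    Tendsto (fun N => ∫ t, f N t * g t ∂μ) atTop (𝓝 (∫ t, ψ t * g t ∂μ)) := by
  have hi : ∀ {u : I → ℂ}, MemLp u ∞ μ → Integrable (fun t => u t * g t) μ := fun hu =>
    (hg.mul (p := ∞) (q := ∞) (r := ∞) hu).integrable le_top
  refine tendsto_integral_of_L1 _ (hi hψ).aestronglyMeasurable
    (Eventually.of_forall fun N => hi (hf N)) ?_
  have hlim := ENNReal.Tendsto.mul_const (b := eLpNorm g 1 μ) h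
    (Or.inr (hg.mono_exponent le_top).2.ne)
  rw [zero_mul] at hlim
  refine tendsto_of_tendsto_of_tendsto_of_le_of_le tendsto_const_nhds hlim
    (fun _ => zero_le) fun N => ?_
  rw [eLpNorm_one_eq_lintegral_enorm, ← lintegral_const_mul'' _ hg.1.enorm]
  refine lintegral_mono_ae ?_
  filter_upwards [enorm_ae_le_eLpNormEssSup (fun t => f N t - ψ t) μ] with t ht
  rw [← sub_mul, enorm_mul, eLpNorm_exponent_top]
  gcongr

theorem memLp_posPartialSum (cI : ℂ) (c : Wavelet O → ℂ) (N : ℕ) :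
    MemLp (posPartialSum O s cI c N) ∞ μ := by
  unfold posPartialSum
  refine (memLp_const cI).add (memLp_finsetSum _ fun k _ => memLp_finsetSum _ fun w _ => ?_)
  exact (memLp_fn _).const_mul _

theorem integral_posPartialSum_mul {g : I → ℂ} (hg : MemLp g ∞ μ) (cI : ℂ) (c : Wavelet O → ℂ)
    (N : ℕ) : ∫ t, posPartialSum O s cI c N t * g t ∂μ = cI * ∫ t, g t ∂μ +
      ∑ k ∈ Finset.range N, ∑ w : WaveletAt O k,
        (((Wavelet.size (O := O) ⟨k, w⟩) ^ (1 + s) : ℝ) : ℂ) * c ⟨k, w⟩ *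
          ∫ t, Wavelet.fn (O := O) ⟨k, w⟩ t * g t ∂μ := by
  have hi : ∀ k (w : WaveletAt O k), Integrable (fun t =>
      (((Wavelet.size (O := O) ⟨k, w⟩) ^ (1 + s) : ℝ) : ℂ) * c ⟨k, w⟩ *
          (Wavelet.fn (O := O) ⟨k, w⟩ t * g t)) μ := fun k w =>
    (integrable_fn_mul _ hg).const_mul _
  simp only [posPartialSum, add_mul, Finset.sum_mul, mul_assoc] at hi ⊢
  rw [integral_add ((hg.integrable le_top).const_mul _)
    (integrable_finsetSum _ fun k _ => integrable_finsetSum _ fun w _ => hi k w),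
    integral_const_mul, integral_finsetSum _ fun k _ => integrable_finsetSum _ fun w _ => hi k w]
  congr 1
  refine Finset.sum_congr rfl fun k _ => ?_
  rw [integral_finsetSum _ fun w _ => hi k w]
  refine Finset.sum_congr rfl fun w _ => ?_
  rw [integral_const_mul, integral_const_mul]

theorem IsPosRep.integral_eq {ψ : Lp ℂ ∞ μ} {cI : ℂ} {c : Wavelet O → ℂ}
    (h : IsPosRep O s ψ cI c) : ∫ t, ψ t ∂μ = cI := by
  have h1 := tendsto_integral_mul_of_eLpNorm (g := fun _ => 1)
    (fun N => memLp_posPartialSum cI c N) (Lp.memLp ψ) (memLp_const 1) h.tendsto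
  have h2 : ∀ N, ∫ t, posPartialSum O s cI c N t * 1 ∂μ = cI := fun N => by
    rw [integral_posPartialSum_mul (memLp_const 1)]
    simp [integral_fn]
  simp only [h2] at h1
  simpa using tendsto_nhds_unique h1 tendsto_const_nhds

/-- By orthogonality the pairing with a partial sum is constant once its level is included, and
$L^\infty$ convergence passes this value to the limit. -/
theorem IsPosRep.integral_mul_fn_eq {ψ : Lp ℂ ∞ μ} {cI : ℂ} {c : Wavelet O → ℂ}
    (h : IsPosRep O s ψ cI c) (w : Wavelet O) :
    ∫ t, ψ t * w.fn t ∂μ = ((w.size ^ (1 + s) : ℝ) : ℂ) * c w * (w.energy : ℂ) := by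
  have h1 := tendsto_integral_mul_of_eLpNorm (g := w.fn)
    (fun N => memLp_posPartialSum cI c N) (Lp.memLp ψ) (memLp_fn w) h.tendsto
  refine tendsto_nhds_unique h1 (tendsto_const_nhds.congr' ?_)
  obtain ⟨k, w⟩ := w
  filter_upwards [eventually_gt_atTop k] with N hN
  rw [integral_posPartialSum_mul (memLp_fn _), integral_fn, mul_zero, zero_add,
    Finset.sum_eq_single k, Finset.sum_eq_single w, integral_fn_mul_self]
  · intro w' _ hw
    rw [integral_fn_mul_fn, mul_zero]
    exact fun h => hw (eq_of_heq (Sigma.mk.inj h).2)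
  · simp
  · intro k' _ hk
    refine Finset.sum_eq_zero fun w' _ => ?_
    rw [integral_fn_mul_fn, mul_zero]
    exact fun h => hk (Sigma.mk.inj h).1
  · intro h
    exact absurd (Finset.mem_range.2 hN) h

variable (O s) in
-- The weights combine to $|Q|^{-s}|Q|^{1+s}=|Q|$, which the wavelet energy compensates. Hence
-- absolutely summable coefficients always give a convergent and continuous functional.
theorem exists_norm_integral_le : ∃ B : ℝ, 0 ≤ B ∧ ∀ ψ : BesovPos O s,
    ‖∫ t, ψ.1 t ∂μ‖ ≤ B * posNorm O s ψ ∧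
    ∀ w : Wavelet O, ‖((w.size ^ (-s) : ℝ) : ℂ) * ∫ t, ψ.1 t * w.fn t ∂μ‖ ≤
      B * posNorm O s ψ := by
  obtain ⟨B, hB, hle⟩ := exists_size_mul_energy_le O
  have hp : (0 : ℝ) < max B 1 := by positivity
  -- `posNorm` is an infimum, so a bound valid for every representation passes to it. In `max B 1`,
  -- the $1$ serves the constant term and `B` the wavelets.
  have key : ∀ (ψ : BesovPos O s) (X : ℝ), (∀ cI c, IsPosRep O s ψ.1 cI c →
      X ≤ max B 1 * (‖cI‖ + ⨆ w, ‖c w‖)) → X ≤ max B 1 * posNorm O s ψ := by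
    intro ψ X h
    rw [← div_le_iff₀' hp]
    obtain ⟨cI, c, hc⟩ := ψ.2
    refine le_csInf ⟨_, cI, c, hc, rfl⟩ ?_
    rintro _ ⟨cI, c, hc, rfl⟩
    rw [div_le_iff₀' hp]
    exact h cI c hc
  refine ⟨max B 1, hp.le, fun ψ => ⟨key ψ _ fun cI c hc => ?_, fun w => key ψ _ fun cI c hc => ?_⟩⟩
  · have h0 : 0 ≤ ⨆ w, ‖c w‖ := Real.iSup_nonneg fun _ => norm_nonneg _
    rw [hc.integral_eq]
    calc ‖cI‖ ≤ 1 * (‖cI‖ + ⨆ w, ‖c w‖) := by linarith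
      _ ≤ _ := mul_le_mul_of_nonneg_right (le_max_right _ _) (by positivity)
  · have hw := size_pos w
    have he := energy_pos w
    have h1 : ‖c w‖ ≤ ⨆ w, ‖c w‖ := le_ciSup hc.bdd w
    have h2 : ((w.size ^ (-s) : ℝ) : ℂ) * (((w.size ^ (1 + s) : ℝ) : ℂ) * c w * (w.energy : ℂ)) =
        ((w.size * w.energy : ℝ) : ℂ) * c w := by
      have : w.size ^ (-s) * w.size ^ (1 + s) = w.size := by
        rw [← Real.rpow_add hw]; simp
      rw [← mul_assoc, ← mul_assoc, ← Complex.ofReal_mul, this]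
      push_cast
      ring
    rw [hc.integral_mul_fn_eq, h2, norm_mul, Complex.norm_real, Real.norm_eq_abs,
      abs_of_pos (by positivity)]
    refine mul_le_mul ((hle w).trans (le_max_left _ _)) ?_ (norm_nonneg _) hp.le
    have := norm_nonneg cI
    linarith

/-- The wavelets belong to `B^s_{∞,∞}`. -/
theorem exists_besovPos_fn (w : Wavelet O) : ∃ ψ : BesovPos O s, ψ.1 =ᵐ[μ] w.fn := by
  classical
  have hw := size_pos w
  have hne : ((w.size ^ (1 + s) : ℝ) : ℂ) ≠ 0 := by
    exact_mod_cast (Real.rpow_pos_of_pos hw _).ne'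
  let c : Wavelet O → ℂ := fun w' => if w' = w then ((w.size ^ (1 + s) : ℝ) : ℂ)⁻¹ else 0
  refine ⟨⟨(memLp_fn w).toLp, 0, c, ?_, ?_⟩, (memLp_fn w).coeFn_toLp⟩
  · refine ⟨‖((w.size ^ (1 + s) : ℝ) : ℂ)⁻¹‖, ?_⟩
    rintro _ ⟨w', rfl⟩
    by_cases h : w' = w
    · simp [c, h]
    · simp only [c, h, if_false, norm_zero]
      positivity
  · have : ∀ N > w.1, ∀ t, posPartialSum O s 0 c N t = w.fn t := by
      intro N hN t
      obtain ⟨k, w⟩ := w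
      rw [posPartialSum, zero_add, Finset.sum_eq_single k, Finset.sum_eq_single w]
      · simp only [c, if_true]
        rw [mul_inv_cancel₀ hne, one_mul]
      · intro w' _ hw
        have : (⟨k, w'⟩ : Wavelet O) ≠ ⟨k, w⟩ := fun h => hw (eq_of_heq (Sigma.mk.inj h).2)
        simp [c, this]
      · simp
      · intro k' _ hk
        refine Finset.sum_eq_zero fun w' _ => ?_
        have : (⟨k', w'⟩ : Wavelet O) ≠ ⟨k, w⟩ := fun h => hk (Sigma.mk.inj h).1
        simp [c, this]
      · intro h
        exact absurd (Finset.mem_range.2 hN) h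
    refine tendsto_const_nhds.congr' ?_
    filter_upwards [eventually_gt_atTop w.1] with N hN
    rw [eLpNorm_congr_ae (g := fun _ => (0 : ℂ)), eLpNorm_zero']
    filter_upwards [(memLp_fn w).coeFn_toLp] with t ht
    rw [ht, this N hN, sub_self]

/-- The constant `1` belongs to `B^s_{∞,∞}`. -/
theorem exists_besovPos_one : ∃ ψ : BesovPos O s, ψ.1 =ᵐ[μ] fun _ => (1 : ℂ) := by
  have h1 : MemLp (fun _ : I => (1 : ℂ)) ∞ μ := memLp_const 1
  refine ⟨⟨h1.toLp, 1, 0, ⟨0, by rintro _ ⟨w, rfl⟩; simp⟩, ?_⟩, h1.coeFn_toLp⟩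
  refine tendsto_const_nhds.congr fun N => ?_
  rw [eLpNorm_congr_ae (g := fun _ => (0 : ℂ)), eLpNorm_zero']
  filter_upwards [h1.coeFn_toLp] with t ht
  rw [ht]
  simp [posPartialSum]

/-- The constant coefficient of a functional is its value at `1`. -/
theorem IsNegRep.eq_const {φ : BesovPos O s →ₗ[ℂ] ℂ} {dI : ℂ} {d : Wavelet O → ℂ}
    (h : IsNegRep O s φ dI d) {ψ : BesovPos O s} (hψ : ψ.1 =ᵐ[μ] fun _ => (1 : ℂ)) :
    φ ψ = dI := by
  refine tendsto_nhds_unique (h.tendsto ψ) (tendsto_const_nhds.congr fun N => ?_)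
  have h1 : ∫ t, ψ.1 t ∂μ = 1 := by rw [integral_congr_ae hψ]; simp
  have h2 : ∀ w : Wavelet O, ∫ t, ψ.1 t * w.fn t ∂μ = 0 := fun w => by
    rw [← integral_fn w]
    exact integral_congr_ae (hψ.mono fun t ht => by simp [ht])
  simp [h1, h2]

/-- The coefficient of a wavelet in a functional is determined by the value at that wavelet. -/
theorem IsNegRep.eq_coef {φ : BesovPos O s →ₗ[ℂ] ℂ} {dI : ℂ} {d : Wavelet O → ℂ}
    (h : IsNegRep O s φ dI d) (w : Wavelet O) {ψ : BesovPos O s} (hψ : ψ.1 =ᵐ[μ] w.fn) :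
    φ ψ = d w * ((w.size ^ (-s) : ℝ) : ℂ) * (w.energy : ℂ) := by
  refine tendsto_nhds_unique (h.tendsto ψ) (tendsto_const_nhds.congr' ?_)
  have h1 : ∫ t, ψ.1 t ∂μ = 0 := by rw [integral_congr_ae hψ, integral_fn]
  have h2 : ∀ w' : Wavelet O, ∫ t, ψ.1 t * w'.fn t ∂μ = ∫ t, w.fn t * w'.fn t ∂μ := fun w' =>
    integral_congr_ae (hψ.mono fun t ht => by simp [ht])
  obtain ⟨k, w⟩ := w
  filter_upwards [eventually_gt_atTop k] with N hN
  rw [h1, mul_zero, zero_add, Finset.sum_eq_single k, Finset.sum_eq_single w, h2,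
    integral_fn_mul_self]
  · intro w' _ hw
    rw [h2, integral_fn_mul_fn, mul_zero]
    exact fun h => hw (eq_of_heq (Sigma.mk.inj h).2).symm
  · simp
  · intro k' _ hk
    refine Finset.sum_eq_zero fun w' _ => ?_
    rw [h2, integral_fn_mul_fn, mul_zero]
    exact fun h => hk (Sigma.mk.inj h).1.symm
  · intro h
    exact absurd (Finset.mem_range.2 hN) h

/-- The representation of a functional is unique. -/
theorem IsNegRep.unique {φ : BesovPos O s →ₗ[ℂ] ℂ} {dI dI' : ℂ} {d d' : Wavelet O → ℂ}
    (h : IsNegRep O s φ dI d) (h' : IsNegRep O s φ dI' d') : dI = dI' ∧ d = d' := by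
  refine ⟨?_, funext fun w => ?_⟩
  · obtain ⟨ψ, hψ⟩ := exists_besovPos_one (O := O) (s := s)
    rw [← h.eq_const hψ, h'.eq_const hψ]
  · obtain ⟨ψ, hψ⟩ := exists_besovPos_fn (s := s) w
    have h1 := (h.eq_coef w hψ).symm.trans (h'.eq_coef w hψ)
    have hs : ((w.size ^ (-s) : ℝ) : ℂ) ≠ 0 := by
      exact_mod_cast (Real.rpow_pos_of_pos (size_pos w) _).ne'
    have he : (w.energy : ℂ) ≠ 0 := by exact_mod_cast (energy_pos w).ne'
    exact mul_right_cancel₀ hs (mul_right_cancel₀ he h1)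

theorem negNorm_eq {φ : BesovNeg O s} {dI : ℂ} {d : Wavelet O → ℂ} (h : IsNegRep O s φ.1 dI d) :
    negNorm O s φ = ‖dI‖ + ∑' w, ‖d w‖ := by
  have : {r | ∃ dI d, IsNegRep O s φ.1 dI d ∧ r = ‖dI‖ + ∑' w, ‖d w‖} =
      {‖dI‖ + ∑' w, ‖d w‖} := by
    ext r
    constructor
    · rintro ⟨dI', d', h', rfl⟩
      obtain ⟨rfl, rfl⟩ := h.unique h'
      rfl
    · rintro rfl
      exact ⟨dI, d, h, rfl⟩
  rw [negNorm, this, csInf_singleton]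

theorem summable_pairing {d : Wavelet O → ℂ} (hd : Summable fun w => ‖d w‖) (ψ : BesovPos O s) :
    Summable fun w : Wavelet O =>
      d w * ((w.size ^ (-s) : ℝ) : ℂ) * ∫ t, ψ.1 t * w.fn t ∂μ := by
  obtain ⟨B, hB, h⟩ := exists_norm_integral_le O s
  refine Summable.of_norm_bounded (hd.mul_right (B * posNorm O s ψ)) fun w => ?_
  rw [mul_assoc, norm_mul]
  exact mul_le_mul_of_nonneg_left ((h ψ).2 w) (norm_nonneg _)

theorem IsNegRep.apply_eq {φ : BesovPos O s →ₗ[ℂ] ℂ} {dI : ℂ} {d : Wavelet O → ℂ}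
    (h : IsNegRep O s φ dI d) (ψ : BesovPos O s) : φ ψ = dI * ∫ t, ψ.1 t ∂μ +
      ∑' w : Wavelet O, d w * ((w.size ^ (-s) : ℝ) : ℂ) * ∫ t, ψ.1 t * w.fn t ∂μ :=
  tendsto_nhds_unique (h.tendsto ψ)
    ((tendsto_sum_wavelet (summable_pairing h.summable ψ)).const_add _)

theorem IsNegRep.mem_besovNeg {φ : BesovPos O s →ₗ[ℂ] ℂ} {dI : ℂ} {d : Wavelet O → ℂ}
    (h : IsNegRep O s φ dI d) : φ ∈ BesovNeg O s := by
  obtain ⟨B, hB, hle⟩ := exists_norm_integral_le O s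
  refine ⟨⟨‖dI‖ * B + (∑' w, ‖d w‖) * B, fun ψ => ?_⟩, dI, d, h⟩
  rw [h.apply_eq ψ, add_mul, mul_assoc, mul_assoc]
  refine (norm_add_le _ _).trans (add_le_add ?_ ?_)
  · rw [norm_mul]
    exact mul_le_mul_of_nonneg_left (hle ψ).1 (norm_nonneg _)
  · rw [← tsum_mul_right]
    refine tsum_of_norm_bounded (h.summable.mul_right _).hasSum fun w => ?_
    rw [mul_assoc, norm_mul]
    exact mul_le_mul_of_nonneg_left ((hle ψ).2 w) (norm_nonneg _)

/-- Absolutely summable coefficients define a functional. -/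
theorem exists_isNegRep (dI : ℂ) {d : Wavelet O → ℂ} (hd : Summable fun w => ‖d w‖) :
    ∃ φ : BesovNeg O s, IsNegRep O s φ.1 dI d := by
  have hint : ∀ (ψ : BesovPos O s) (w : Wavelet O), Integrable (fun t => ψ.1 t * w.fn t) μ :=
    fun ψ w => by
      simp only [mul_comm _ (w.fn _)]
      exact integrable_fn_mul w (Lp.memLp ψ.1)
  let φ : BesovPos O s →ₗ[ℂ] ℂ :=
    { toFun := fun ψ => dI * ∫ t, ψ.1 t ∂μ +
        ∑' w : Wavelet O, d w * ((w.size ^ (-s) : ℝ) : ℂ) * ∫ t, ψ.1 t * w.fn t ∂μ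
      map_add' := fun ψ ψ' => by
        have hc : ∀ᵐ t ∂μ, (ψ + ψ').1 t = ψ.1 t + ψ'.1 t := Lp.coeFn_add ψ.1 ψ'.1
        have h1 : ∫ t, (ψ + ψ').1 t ∂μ = ∫ t, ψ.1 t ∂μ + ∫ t, ψ'.1 t ∂μ := by
          rw [integral_congr_ae hc, integral_add ((Lp.memLp ψ.1).integrable le_top)
            ((Lp.memLp ψ'.1).integrable le_top)]
        have h2 : ∀ w : Wavelet O, ∫ t, (ψ + ψ').1 t * w.fn t ∂μ =
            ∫ t, ψ.1 t * w.fn t ∂μ + ∫ t, ψ'.1 t * w.fn t ∂μ := fun w => by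
          rw [← integral_add (hint ψ w) (hint ψ' w)]
          exact integral_congr_ae (hc.mono fun t ht => by simp only [ht, add_mul])
        simp only [h1, h2, mul_add]
        rw [(summable_pairing hd ψ).tsum_add (summable_pairing hd ψ')]
        ring
      map_smul' := fun a ψ => by
        have hc : ∀ᵐ t ∂μ, (a • ψ).1 t = a * ψ.1 t := Lp.coeFn_smul a ψ.1
        have h1 : ∫ t, (a • ψ).1 t ∂μ = a * ∫ t, ψ.1 t ∂μ := by
          rw [integral_congr_ae hc, integral_const_mul]
        have h2 : ∀ w : Wavelet O, ∫ t, (a • ψ).1 t * w.fn t ∂μ =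
            a * ∫ t, ψ.1 t * w.fn t ∂μ := fun w => by
          rw [← integral_const_mul]
          exact integral_congr_ae (hc.mono fun t ht => by simp only [ht, mul_assoc])
        simp only [h1, h2, mul_left_comm _ a, tsum_mul_left, RingHom.id_apply, smul_eq_mul, mul_add] }
  have h : IsNegRep O s φ dI d :=
    ⟨hd, fun ψ => (tendsto_sum_wavelet (summable_pairing hd ψ)).const_add _⟩
  exact ⟨⟨φ, h.mem_besovNeg⟩, h⟩

theorem IsNegRep.ext {φ φ' : BesovNeg O s} {dI : ℂ} {d : Wavelet O → ℂ}
    (h : IsNegRep O s φ.1 dI d) (h' : IsNegRep O s φ'.1 dI d) : φ = φ' := by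
  refine Subtype.ext (LinearMap.ext fun ψ => ?_)
  rw [h.apply_eq, h'.apply_eq]

/-- The triangle inequality in the form needed for uniqueness of limits: `χ` will be an
approximating cell average. -/
theorem negNorm_sub_le (φ φ' χ : BesovNeg O s) :
    negNorm O s (φ - φ') ≤ negNorm O s (χ - φ) + negNorm O s (χ - φ') := by
  obtain ⟨dI, d, h⟩ := φ.2.2
  obtain ⟨dI', d', h'⟩ := φ'.2.2
  obtain ⟨eI, e, he⟩ := χ.2.2
  have r1 := he.sub h
  have r2 := he.sub h'
  rw [negNorm_eq (φ := φ - φ') (h.sub h'), negNorm_eq (φ := χ - φ) r1,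
    negNorm_eq (φ := χ - φ') r2]
  have h1 : ‖dI - dI'‖ ≤ ‖eI - dI‖ + ‖eI - dI'‖ := by
    rw [norm_sub_rev eI dI]
    exact norm_sub_le_norm_sub_add_norm_sub _ _ _
  have h2 : ∑' w, ‖(d - d') w‖ ≤ ∑' w, (‖(e - d) w‖ + ‖(e - d') w‖) := by
    refine (h.sub h').summable.tsum_le_tsum (fun w => ?_) (r1.summable.add r2.summable)
    simp only [Pi.sub_apply]
    rw [norm_sub_rev (e w) (d w)]
    exact norm_sub_le_norm_sub_add_norm_sub _ _ _
  rw [r1.summable.tsum_add r2.summable] at h2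
  linarith

theorem negNorm_nonneg (φ : BesovNeg O s) : 0 ≤ negNorm O s φ := by
  obtain ⟨dI, d, h⟩ := φ.2.2
  rw [negNorm_eq h]
  exact add_nonneg (norm_nonneg _) (tsum_nonneg fun _ => norm_nonneg _)

theorem eq_of_negNorm_sub_eq_zero {φ φ' : BesovNeg O s} (h0 : negNorm O s (φ - φ') = 0) :
    φ = φ' := by
  obtain ⟨dI, d, h⟩ := φ.2.2
  obtain ⟨dI', d', h'⟩ := φ'.2.2
  rw [negNorm_eq (φ := φ - φ') (h.sub h'), add_eq_zero_iff_of_nonneg (norm_nonneg _)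
    (tsum_nonneg fun _ => norm_nonneg _),
    ← (h.sub h').summable.hasSum_iff, hasSum_zero_iff_of_nonneg fun _ => norm_nonneg _] at h0
  obtain rfl : dI = dI' := sub_eq_zero.1 (norm_eq_zero.1 h0.1)
  obtain rfl : d = d' := funext fun w => sub_eq_zero.1 (norm_eq_zero.1 (congrFun h0.2 w))
  exact h.ext h'

/-- The Dirac mass is unique. -/
theorem IsDirac.unique {x : HatPoint G} {δ δ' : BesovNeg O s} (h : IsDirac O s x δ)
    (h' : IsDirac O s x δ') : δ = δ' := by
  obtain ⟨u, hu, ht⟩ := h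
  obtain ⟨u', hu', ht'⟩ := h'
  -- Both approximating sequences consist of the same cell averages, so they coincide.
  obtain rfl : u = u' := funext fun j => Subtype.ext ((hu j).trans (hu' j).symm)
  refine eq_of_negNorm_sub_eq_zero (le_antisymm ?_ (negNorm_nonneg _))
  have h0 := ht.add ht'
  rw [add_zero] at h0
  exact ge_of_tendsto' h0 fun j => negNorm_sub_le δ δ' (u j)

end Duality

/-! ### Coefficients of Dirac masses and the two-sided estimate -/

section Dirac

variable {I : Type*} [MeasurableSpace I] {μ : Measure I} {G : GoodGrid μ}

theorem HatPoint.mem_children (x : HatPoint G) (O : ChildOrder G) (k : ℕ) :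
    x.cell (k + 1) ∈ O.children k (x.cell k) :=
  (O.mem_iff k _ (x.mem k) _).2 ⟨x.mem (k + 1), x.subset k⟩

theorem HatPoint.cell_zero (x : HatPoint G) : x.cell 0 = Set.univ := by
  simpa [G.parts_zero] using x.mem 0

theorem hatDist_eq_of_ne {x y : HatPoint G} (h : x ≠ y) :
    ∃ n, x.cell n = y.cell n ∧ x.cell (n + 1) ≠ y.cell (n + 1) ∧
      hatDist x y = μ.real (x.cell n) := by
  classical
  have hex : ∃ n, x.cell n = y.cell n ∧ x.cell (n + 1) ≠ y.cell (n + 1) := by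
    by_contra hcon
    push Not at hcon
    refine h (HatPoint.ext (funext fun n => ?_))
    induction n with
    | zero => rw [x.cell_zero, y.cell_zero]
    | succ n ih => exact hcon n ih
  exact ⟨Nat.find hex, (Nat.find_spec hex).1, (Nat.find_spec hex).2, by rw [hatDist, dif_pos hex]⟩

theorem hatDist_self (x : HatPoint G) : hatDist x x = 0 := by
  rw [hatDist, dif_neg]
  rintro ⟨n, -, h⟩
  exact h rfl

variable (O : ChildOrder G) (s : ℝ)

open Classical in
/-- The coefficients of the Dirac mass at `x`. -/
def diracCoef (x : HatPoint G) (w : Wavelet O) : ℂ :=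
  if w.2.1.1 = x.cell w.1 then
    ((μ.real (x.cell w.1) ^ s * haarCoef μ w.2.2.1 (x.cell (w.1 + 1)) : ℝ) : ℂ)
  else 0

open Classical in
theorem sum_waveletAt_ite {E : Type*} [AddCommMonoid E] {k : ℕ} {Q : Set I} (hQ : Q ∈ G.parts k)
    (F : List (Set I) × List (Set I) → E) :
    ∑ w : WaveletAt O k, (if w.1.1 = Q then F w.2.1 else 0) =
      ((haarPairs (O.children k Q)).map F).sum := by
  have : (Finset.univ : Finset (WaveletAt O k)) =
      Finset.univ.sigma (fun Q : {Q // Q ∈ G.parts k} =>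
        (haarPairs (O.children k Q.1)).toFinset.subtype (· ∈ haarPairs (O.children k Q.1))) := by
    ext w
    simp [w.2.2]
  rw [this, Finset.sum_sigma, Finset.sum_eq_single ⟨Q, hQ⟩]
  · simp only [if_true]
    rw [Finset.sum_subtype_of_mem F (by simp),
      List.sum_toFinset F (nodup_haarPairs (O.nodup k Q hQ))]
  · intro Q' _ hne
    refine Finset.sum_eq_zero fun p _ => if_neg fun h => hne (Subtype.ext h)
  · simp

variable [IsProbabilityMeasure μ]

theorem HatPoint.eq_of_le {x y : HatPoint G} {k n : ℕ} (hkn : k ≤ n) (h : x.cell n = y.cell n) :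
    x.cell k = y.cell k := by
  induction n, hkn using Nat.le_induction with
  | base => exact h
  | succ n _ ih =>
    exact ih (G.eq_of_subset (x.mem n) (y.mem n) (x.mem (n + 1)) (x.subset n) (h ▸ y.subset n))

/-- Only one cell per level contributes, with at most `B` wavelets, each coefficient being at most
$|Q_{n+k}|^s\le(b^s)^k|Q_n|^s$; hence $r=b^s$. The starting level `n` is kept free: $n=0$ gives
summability, the last common level gives the upper bound. -/
theorem exists_sum_norm_diracCoef_le (hs : 0 < s) : ∃ B : ℝ, 0 ≤ B ∧ ∃ r ∈ Set.Ioo (0 : ℝ) 1,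
    ∀ (x : HatPoint G) (n k : ℕ), ∑ w : WaveletAt O (n + k), ‖diracCoef O s x ⟨n + k, w⟩‖ ≤
      B * μ.real (x.cell n) ^ s * r ^ k := by
  obtain ⟨B, hB, hlen⟩ := exists_length_haarPairs_le O
  obtain ⟨a, ha, b, hb, h⟩ := G.measureReal_bounds
  refine ⟨B, hB, b ^ s, ⟨Real.rpow_pos_of_pos hb.1 s, Real.rpow_lt_one hb.1.le hb.2 hs⟩,
    fun x n k => ?_⟩
  have h1 : μ.real (x.cell (n + k)) ≤ b ^ k * μ.real (x.cell n) := by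
    induction k with
    | zero => simp
    | succ k ih =>
      refine (h (n + k) _ (x.mem _) _ (x.mem _) (x.subset _)).2.trans ?_
      rw [pow_succ', mul_assoc]
      exact mul_le_mul_of_nonneg_left ih hb.1.le
  have h2 : μ.real (x.cell (n + k)) ^ s ≤ (b ^ s) ^ k * μ.real (x.cell n) ^ s := by
    refine (Real.rpow_le_rpow measureReal_nonneg h1 hs.le).trans_eq ?_
    rw [Real.mul_rpow (pow_nonneg hb.1.le k) measureReal_nonneg, ← Real.rpow_natCast,
      ← Real.rpow_natCast, ← Real.rpow_mul hb.1.le, ← Real.rpow_mul hb.1.le, mul_comm s]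
  have h0 : 0 ≤ μ.real (x.cell (n + k)) ^ s := Real.rpow_nonneg measureReal_nonneg s
  have h3 := sum_waveletAt_ite O (x.mem (n + k)) fun p =>
    ‖((μ.real (x.cell (n + k)) ^ s * haarCoef μ p (x.cell (n + k + 1)) : ℝ) : ℂ)‖
  simp only [diracCoef, apply_ite norm, norm_zero]
  rw [h3]
  refine (List.sum_le_card_nsmul _ (μ.real (x.cell (n + k)) ^ s) ?_).trans ?_
  · intro y hy
    obtain ⟨p, hp, rfl⟩ := List.mem_map.1 hy
    rw [Complex.norm_real, Real.norm_eq_abs, abs_mul, abs_of_nonneg h0]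
    exact mul_le_of_le_one_right h0 (abs_haarCoef_le_one μ _ _)
  · rw [List.length_map, nsmul_eq_mul]
    calc _ ≤ B * ((b ^ s) ^ k * μ.real (x.cell n) ^ s) :=
          mul_le_mul (hlen _ _ (x.mem _)) h2 h0 hB
      _ = _ := by ring

theorem summable_diracCoef (hs : 0 < s) (x : HatPoint G) :
    Summable fun w => ‖diracCoef O s x w‖ := by
  obtain ⟨B, hB, r, hr, h⟩ := exists_sum_norm_diracCoef_le O s hs
  refine (summable_sigma_of_nonneg fun _ => norm_nonneg _).2
    ⟨fun k => Summable.of_finite, ?_⟩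
  simp only [tsum_fintype]
  refine Summable.of_nonneg_of_le (fun k => Finset.sum_nonneg fun _ _ => norm_nonneg _)
    (fun k => ?_) ((summable_geometric_of_lt_one hr.1.le hr.2).mul_left
      (B * μ.real (x.cell 0) ^ s))
  have := h x 0 k
  rwa [Nat.zero_add] at this

/-- The Haar expansion of a normalized cell. -/
theorem cell_indicator_div_eq_sum (x : HatPoint G) (j : ℕ) {t : I} (ht : G.IsRegular t) :
    (x.cell j).indicator (fun _ => (1 : ℂ)) t / (μ.real (x.cell j) : ℂ) =
      1 + ∑ k ∈ Finset.range j, ∑ w : WaveletAt O k, diracCoef O s x ⟨k, w⟩ *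
        (((Wavelet.size (O := O) ⟨k, w⟩) ^ (-s) : ℝ) : ℂ) * Wavelet.fn (O := O) ⟨k, w⟩ t := by
  classical
  induction j with
  | zero => simp [x.cell_zero]
  | succ j ih =>
    -- Passing from $Q_j$ to its child adds exactly the wavelets of $Q_j$: the list expansion
    -- applied to its children, whose indicators sum to that of $Q_j$ at a regular point.
    rw [Finset.sum_range_succ, ← add_assoc, ← ih,
      indicator_div_eq_sum (O.nodup j _ (x.mem j))
        (fun P hP => G.measureReal_pos ((O.mem_iff j _ (x.mem j) P).1 hP).1) (x.mem_children O j),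
      indSum_children O (x.mem j) ht, mass_children O (x.mem j), ← sum_waveletAt_ite O (x.mem j)]
    congr 1
    refine Finset.sum_congr rfl fun w _ => ?_
    by_cases h : w.1.1 = x.cell j
    · have hpos := G.measureReal_pos (x.mem j)
      have h1 : μ.real (x.cell j) ^ s * μ.real (x.cell j) ^ (-s) = 1 := by
        rw [← Real.rpow_add hpos]; simp
      have h2 : (Wavelet.size (O := O) ⟨j, w⟩) = μ.real (x.cell j) := by
        rw [Wavelet.size, h]
      rw [if_pos h, diracCoef, if_pos h, h2, ← Complex.ofReal_mul, mul_right_comm, h1, one_mul]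
      rfl
    · rw [if_neg h, diracCoef, if_neg h, zero_mul, zero_mul]

open Classical in
-- Integrating the finite Haar expansion of the normalized cell against `ψ` gives the Dirac
-- coefficients truncated at level `j`, so the limit in `j` is visible on coefficients.
theorem isNegRep_cellAverage (hs : 0 < s) (x : HatPoint G) (j : ℕ) :
    IsNegRep O s (cellAverage O s (x.cell j)) 1
      (fun w => if w.1 < j then diracCoef O s x w else 0) := by
  refine ⟨Summable.of_nonneg_of_le (fun _ => norm_nonneg _) (fun w => ?_)
    (summable_diracCoef O s hs x), fun ψ => tendsto_const_nhds.congr' ?_⟩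
  · split_ifs
    · exact le_rfl
    · simp
  · filter_upwards [eventually_ge_atTop j] with N hN
    have hi : ∀ k (w : WaveletAt O k), Integrable (fun t => diracCoef O s x ⟨k, w⟩ *
        (((Wavelet.size (O := O) ⟨k, w⟩) ^ (-s) : ℝ) : ℂ) *
        (ψ.1 t * Wavelet.fn (O := O) ⟨k, w⟩ t)) μ := fun k w => by
      simp only [mul_comm (ψ.1 _)]
      exact (integrable_fn_mul _ (Lp.memLp ψ.1)).const_mul _
    have h1 : cellAverage O s (x.cell j) ψ = ∫ t, (ψ.1 t + ∑ k ∈ Finset.range j,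
        ∑ w : WaveletAt O k, diracCoef O s x ⟨k, w⟩ *
        (((Wavelet.size (O := O) ⟨k, w⟩) ^ (-s) : ℝ) : ℂ) *
        (ψ.1 t * Wavelet.fn (O := O) ⟨k, w⟩ t)) ∂μ := by
      change ((μ.real (x.cell j) : ℝ) : ℂ)⁻¹ * ∫ t in x.cell j, ψ.1 t ∂μ = _
      rw [← integral_indicator (G.measurable j _ (x.mem j)), ← integral_const_mul]
      refine integral_congr_ae (G.ae_isRegular.mono fun t ht => ?_)
      have h2 : (μ.real (x.cell j) : ℂ)⁻¹ * (x.cell j).indicator (fun t => ψ.1 t) t =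
          ψ.1 t * ((x.cell j).indicator (fun _ => (1 : ℂ)) t / (μ.real (x.cell j) : ℂ)) := by
        by_cases h : t ∈ x.cell j
        · simp [h]; ring
        · simp [h]
      simp only [h2, cell_indicator_div_eq_sum O s x j ht, mul_add, mul_one, Finset.mul_sum,
        mul_left_comm (ψ.1 t)]
    rw [h1, integral_add ((Lp.memLp ψ.1).integrable le_top)
      (integrable_finsetSum _ fun k _ => integrable_finsetSum _ fun w _ => hi k w), one_mul,
      integral_finsetSum _ fun k _ => integrable_finsetSum _ fun w _ => hi k w]
    congr 1
    rw [← Finset.sum_subset (Finset.range_mono hN)]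
    · refine Finset.sum_congr rfl fun k hk => ?_
      rw [integral_finsetSum _ fun w _ => hi k w]
      refine Finset.sum_congr rfl fun w _ => ?_
      rw [integral_const_mul, if_pos (Finset.mem_range.1 hk)]
    · intro k _ hk
      have : ¬ k < j := fun h => hk (Finset.mem_range.2 h)
      simp [this]

/-- The Dirac mass exists, and its coefficients are `diracCoef`. -/
theorem exists_isDirac (hs : 0 < s) (x : HatPoint G) :
    ∃ δ : BesovNeg O s, IsDirac O s x δ ∧ IsNegRep O s δ.1 1 (diracCoef O s x) := by
  classical
  have hsum := summable_diracCoef O s hs x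
  obtain ⟨δ, hδ⟩ := exists_isNegRep (s := s) 1 hsum
  refine ⟨δ, ⟨fun j => ⟨_, (isNegRep_cellAverage O s hs x j).mem_besovNeg⟩, fun _ => rfl, ?_⟩, hδ⟩
  have h : ∀ j, negNorm O s (⟨_, (isNegRep_cellAverage O s hs x j).mem_besovNeg⟩ - δ) =
      ∑' w : Wavelet O, ‖(if w.1 < j then diracCoef O s x w else 0) - diracCoef O s x w‖ := by
    intro j
    rw [negNorm_eq ((isNegRep_cellAverage O s hs x j).sub hδ), sub_self, norm_zero, zero_add]
    rfl
  simp only [h]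
  rw [← tsum_zero (α := ℝ) (β := Wavelet O)]
  -- Each coefficient is eventually exact, and the error never exceeds the summable full
  -- coefficient.
  refine tendsto_tsum_of_dominated_convergence hsum (fun w => ?_) (Eventually.of_forall fun j w => ?_)
  · refine tendsto_const_nhds.congr' ?_
    filter_upwards [eventually_gt_atTop w.1] with j hj
    rw [if_pos hj, sub_self, norm_zero]
  · rw [norm_norm]
    split_ifs
    · simp
    · simp

variable {O s}

theorem IsDirac.isNegRep (hs : 0 < s) {x : HatPoint G} {δ : BesovNeg O s}
    (h : IsDirac O s x δ) : IsNegRep O s δ.1 1 (diracCoef O s x) := by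
  obtain ⟨δ', h', hr⟩ := exists_isDirac O s hs x
  rwa [h.unique h']

theorem negNorm_dirac_sub (hs : 0 < s) {x y : HatPoint G} {δx δy : BesovNeg O s}
    (hx : IsDirac O s x δx) (hy : IsDirac O s y δy) : negNorm O s (δx - δy) =
      ∑' w : Wavelet O, ‖diracCoef O s x w - diracCoef O s y w‖ := by
  rw [negNorm_eq (φ := δx - δy) ((hx.isNegRep hs).sub (hy.isNegRep hs)), sub_self, norm_zero,
    zero_add]
  rfl

theorem summable_norm_diracCoef_sub (hs : 0 < s) (x y : HatPoint G) :
    Summable fun w : Wavelet O => ‖diracCoef O s x w - diracCoef O s y w‖ :=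
  Summable.of_nonneg_of_le (fun _ => norm_nonneg _) (fun _ => norm_sub_le _ _)
    ((summable_diracCoef O s hs x).add (summable_diracCoef O s hs y))

/-- The distance of two Dirac masses is bounded below by the wavelet which separates them. -/
theorem le_negNorm_dirac_sub (hs : 0 < s) {x y : HatPoint G} {δx δy : BesovNeg O s}
    (hx : IsDirac O s x δx) (hy : IsDirac O s y δy) {n : ℕ} (h : x.cell n = y.cell n)
    (hne : x.cell (n + 1) ≠ y.cell (n + 1)) :
    μ.real (x.cell n) ^ s ≤ negNorm O s (δx - δy) := by
  obtain ⟨p, hp, hsep⟩ := exists_haarPairs_separating (x.mem_children O n)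
    (h ▸ y.mem_children O n) hne
  obtain ⟨m1, m2⟩ := mass_pos_of_mem_haarPairs O (x.mem n) hp
  have hd := (disjoint_of_mem_haarPairs (O.nodup n _ (x.mem n)) hp).2.2
  rw [negNorm_dirac_sub hs hx hy]
  refine le_trans (le_of_eq ?_) ((summable_norm_diracCoef_sub hs x y).le_tsum
    (⟨n, ⟨x.cell n, x.mem n⟩, ⟨p, hp⟩⟩ : Wavelet O) fun _ _ => norm_nonneg _)
  have hc : |haarCoef μ p (x.cell (n + 1)) - haarCoef μ p (y.cell (n + 1))| = 1 := by
    rcases hsep with h | h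
    · rw [haarCoef_sub_haarCoef m1 m2 hd h.1 h.2, abs_one]
    · rw [abs_sub_comm, haarCoef_sub_haarCoef m1 m2 hd h.1 h.2, abs_one]
  simp only [diracCoef, if_true, ← h]
  rw [← Complex.ofReal_sub, ← mul_sub, Complex.norm_real, Real.norm_eq_abs, abs_mul, hc, mul_one,
    abs_of_nonneg (Real.rpow_nonneg measureReal_nonneg s)]

variable (O) in
-- Levels below `n` cancel, and the remaining ones cost a geometric series for each of the two
-- points, hence $2B/(1-r)$.
theorem exists_negNorm_dirac_sub_le (hs : 0 < s) : ∃ C : ℝ, 0 ≤ C ∧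
    ∀ (x y : HatPoint G) (δx δy : BesovNeg O s), IsDirac O s x δx → IsDirac O s y δy →
      ∀ n, x.cell n = y.cell n → negNorm O s (δx - δy) ≤ C * μ.real (x.cell n) ^ s := by
  obtain ⟨B, hB, r, hr, hle⟩ := exists_sum_norm_diracCoef_le O s hs
  have hr1 : 0 < 1 - r := by linarith [hr.2]
  refine ⟨2 * B * (1 - r)⁻¹, by positivity, fun x y δx δy hx hy n hn => ?_⟩
  have hsum := summable_norm_diracCoef_sub (O := O) hs x y
  have hsum' := hsum.sigma
  rw [negNorm_dirac_sub hs hx hy, hsum.tsum_sigma]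
  simp only [tsum_fintype] at hsum' ⊢
  rw [← hsum'.sum_add_tsum_nat_add n, Finset.sum_eq_zero, zero_add]
  · have hb : ∀ k, ∑ w : WaveletAt O (k + n),
        ‖diracCoef O s x ⟨k + n, w⟩ - diracCoef O s y ⟨k + n, w⟩‖ ≤
          2 * B * μ.real (x.cell n) ^ s * r ^ k := by
      intro k
      have h1 := hle x n k
      have h2 := hle y n k
      rw [← hn] at h2
      rw [add_comm n k] at h1 h2
      refine (Finset.sum_le_sum fun w _ => norm_sub_le _ _).trans ?_
      rw [Finset.sum_add_distrib]
      linarith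
    have hg := (hasSum_geometric_of_lt_one hr.1.le hr.2).mul_left (2 * B * μ.real (x.cell n) ^ s)
    refine (((summable_nat_add_iff n).2 hsum').tsum_le_tsum hb hg.summable).trans_eq ?_
    rw [hg.tsum_eq]
    ring
  · intro k hk
    have hk := Finset.mem_range.1 hk
    refine Finset.sum_eq_zero fun w _ => ?_
    -- A coefficient of level `k` involves only the cells of levels `k` and `k + 1`; both are common
    -- since `k < n`.
    simp only [diracCoef, HatPoint.eq_of_le hk.le hn, HatPoint.eq_of_le (Nat.succ_le_of_lt hk) hn]
    simp

end Dirac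

end GridBesov

end

/-! ### The corollary -/

open GridBesov
theorem mainTheorem4 {I : Type*} [MeasurableSpace I] (μ : MeasureTheory.Measure I)
    [MeasureTheory.IsProbabilityMeasure μ] (G : GoodGrid μ) (O : ChildOrder G)
    (s : ℝ) (hs : 0 < s) :
    (∀ x : HatPoint G, ∃! δ : BesovNeg O s, IsDirac O s x δ) ∧
    ∃ C : ℝ, 1 < C ∧
      (∀ (x y : HatPoint G) (δx δy : BesovNeg O s), IsDirac O s x δx → IsDirac O s y δy →
        ∀ (n : ℕ), ∀ P ∈ G.parts n, ∀ Q₁ ∈ G.parts (n + 1), ∀ Q₂ ∈ G.parts (n + 1),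
          x.cell n = P → y.cell n = P → x.cell (n + 1) = Q₁ → y.cell (n + 1) = Q₂ → Q₁ ≠ Q₂ →
          1 / C * μ.real P ^ s ≤ negNorm O s (δx - δy) ∧
            negNorm O s (δx - δy) ≤ C * μ.real P ^ s) ∧
      (∀ (x y : HatPoint G) (δx δy : BesovNeg O s), IsDirac O s x δx → IsDirac O s y δy →
        1 / C * hatDist x y ^ s ≤ negNorm O s (δx - δy) ∧
          negNorm O s (δx - δy) ≤ C * hatDist x y ^ s) := by
  obtain ⟨C, hC, hle⟩ := exists_negNorm_dirac_sub_le O hs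
  -- Since only `0 ≤ C` is known, `C + 2` is used: it exceeds $1$, and its reciprocal is at most the
  -- lower constant $1$.
  have key : ∀ (x y : HatPoint G) (δx δy : BesovNeg O s), IsDirac O s x δx → IsDirac O s y δy →
      ∀ n, x.cell n = y.cell n → x.cell (n + 1) ≠ y.cell (n + 1) →
        1 / (C + 2) * μ.real (x.cell n) ^ s ≤ negNorm O s (δx - δy) ∧
          negNorm O s (δx - δy) ≤ (C + 2) * μ.real (x.cell n) ^ s := by
    intro x y δx δy hx hy n h hne
    have h0 : 0 ≤ μ.real (x.cell n) ^ s := Real.rpow_nonneg measureReal_nonneg s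
    refine ⟨le_trans ?_ (le_negNorm_dirac_sub hs hx hy h hne),
      (hle x y δx δy hx hy n h).trans (mul_le_mul_of_nonneg_right (by linarith) h0)⟩
    exact mul_le_of_le_one_left h0 (div_le_one_of_le₀ (by linarith) (by linarith))
  refine ⟨fun x => ?_, C + 2, by linarith, ?_, fun x y δx δy hx hy => ?_⟩
  · obtain ⟨δ, hδ, -⟩ := exists_isDirac O s hs x
    exact ⟨δ, hδ, fun δ' h' => h'.unique hδ⟩
  · rintro x y δx δy hx hy n _ - _ - _ - rfl hP rfl rfl hne
    exact key x y δx δy hx hy n hP.symm hne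
  · by_cases hxy : x = y
    · subst hxy
      -- For equal points both sides vanish, using $0^s=0$ for $s\ne0$.
      have h0 : negNorm O s (δx - δy) = 0 := by simp [negNorm_dirac_sub hs hx hy]
      simp [h0, hatDist_self, Real.zero_rpow hs.ne']
    · obtain ⟨n, hn, hne, hd⟩ := hatDist_eq_of_ne hxy
      rw [hd]
      exact key x y δx δy hx hy n hn hne
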